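/- Theorem 1.1. All graphs are undirected and simple (no loops or multiple edges), and may be infinite. For vertices $u,v$ of a graph $G$ let $d(u,v)$ be the length of a shortest $(u,v)$-path and let $I(u,v)=\{x : d(u,x)+d(x,v)=d(u,v)\}$. A square of $G$ is an induced $4$-cycle of $G$. We say that $G$ satisfies the interval condition if, whenever $d(u,v)=2$, the subgraph induced by $I(u,v)$ is a square, a pyramid (the $4$-wheel, i.e. a $4$-cycle together with a vertex adjacent to all of its vertices) or an octahedron ($K_6$ minus a perfect matching). We say that $G$ satisfies the positioning condition if $d(v,u_1)+d(v,u_3)=d(v,u_2)+d(v,u_4)$ for every vertex $v$ and every square $u_1u_2u_3u_4$ of $G$. The basis graph of a matroid (on a finite set) has the bases of the matroid as its vertices, two bases $A,B$ being adjacent if and only if $|A\,\Delta\, B|=2$. Then a graph $G$ is (isomorphic to) the basis graph of a matroid if and only if $G$ is connected, satisfies the interval condition and the positioning condition, and has at least one vertex with finitely many neighbors. -/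

import Mathlib

/-- The basis graph of a matroid: the vertices are the bases, and two bases are adjacent
when they differ by an elementary exchange, i.e. their symmetric difference has two elements. -/
def Matroid.basisGraph {I : Type*} (M : Matroid I) : SimpleGraph {B : Set I // M.IsBase B} where
  Adj A B := (symmDiff (A : Set I) (B : Set I)).ncard = 2
  symm := ⟨fun A B h => by rwa [symmDiff_comm]⟩
  loopless := ⟨fun A h => by simp at h⟩

namespace SimpleGraph

/-- `G` is (isomorphic to) the basis graph of a matroid on a finite set. Finite sets in `Type`
represent all finite sets up to bijection. -/
def IsMatroidBasisGraph {V : Type*} (G : SimpleGraph V) : Prop :=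
  ∃ (I : Type) (_ : Finite I) (M : Matroid I), Nonempty (G ≃g M.basisGraph)

/-- The pyramid, i.e. the wheel `W₄`: a central vertex `none` joined to all vertices of the
4-cycle on `Fin 4`. -/
def pyramid : SimpleGraph (Option (Fin 4)) where
  Adj
    | none, none => False
    | none, some _ => True
    | some _, none => True
    | some i, some j => (cycleGraph 4).Adj i j
  symm := ⟨by
    rintro (_ | i) (_ | j) h
    · exact h
    · trivial
    · trivial
    · exact (cycleGraph 4).adj_symm h⟩
  loopless := ⟨by
    rintro (_ | i) h
    · exact h
    · exact (cycleGraph 4).irrefl h⟩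

/-- The octahedron: the complete graph on six vertices minus a perfect matching. -/
abbrev octahedron : SimpleGraph (Fin 3 × Fin 2) := completeEquipartiteGraph 3 2

/-- The interval `I(u,v)`: all vertices `x` with `d(u,x) + d(x,v) = d(u,v)`. -/
def interval {V : Type*} (G : SimpleGraph V) (u v : V) : Set V :=
  {x | G.dist u x + G.dist x v = G.dist u v}

/-- The interval condition: each 2-interval induces a square, a pyramid or an octahedron. -/
def IntervalCondition {V : Type*} (G : SimpleGraph V) : Prop :=
  ∀ u v : V, G.dist u v = 2 →
    Nonempty (G.induce (G.interval u v) ≃g cycleGraph 4) ∨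
    Nonempty (G.induce (G.interval u v) ≃g pyramid) ∨
    Nonempty (G.induce (G.interval u v) ≃g octahedron)

/-- The positioning condition: for each vertex `v` and each square (induced 4-cycle)
`u 0, u 1, u 2, u 3` one has `d(v,u₀) + d(v,u₂) = d(v,u₁) + d(v,u₃)`. -/
def PositioningCondition {V : Type*} (G : SimpleGraph V) : Prop :=
  ∀ (v : V) (u : cycleGraph 4 ↪g G),
    G.dist v (u 0) + G.dist v (u 2) = G.dist v (u 1) + G.dist v (u 3)

end SimpleGraph

/-! Call the subgraph induced on the neighbors of `v` the link of `v`. The bulk of the proof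
recovers a ground set from one finite link.

In the basis graph of a matroid, a neighbor of `v` swaps one element out and one element in, so the
link is the line graph of a bipartite graph. The conditions force this in general. The interval
condition excludes induced diamonds from links (`no_diamond`); with positioning, it also excludes
claws (`no_claw`) and odd holes (`not_isLinkHole`). Without diamonds and claws, the edges of the
link split into cliques, at most two through each vertex. Without odd holes, the intersection graph
of these cliques is bipartite. Its 2-coloring gives each neighbor two coordinates, the swapped
elements (`exists_link_coordinates`).

These coordinates extend to an isometric labelling by sets, one distance level at a time
(`exists_ball_embedding`). A vertex `x` is opposite a vertex `z` two levels lower in a square with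
sides `p`, `q`, and receives the union of the labels of `p` and `q`. Positioning, and the modularity
of the size of a symmetric difference with a fixed set, keep all distances correct. The finite link
bounds the ground set, hence the diameter, so finitely many levels suffice. Basis exchange for the
labels then follows by walking along geodesics through squares (`exchange`).

Conversely, distance in a basis graph is the size of a set difference. In a square the two opposite
pairs have equal unions and equal intersections, which gives positioning. Symmetric exchange
produces a square in every 2-interval, and at most two further common neighbors exist. -/

namespace SimpleGraph

/-! ### Local consequences of the two conditions: links without diamonds and claws. -/

/-- The features common to squares, pyramids and octahedra: any two distinct nonadjacent vertices
are opposite in a square, their common neighbors contain no triangle, and each common neighbor has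
at most one non-neighbor among the others. -/
structure IsIntervalLike {W : Type*} (H : SimpleGraph W) : Prop where
  exists_square : ∀ u v, u ≠ v → ¬ H.Adj u v → ∃ p q, H.Adj u p ∧ H.Adj v p ∧ H.Adj u q ∧ H.Adj v q ∧
    p ≠ q ∧ ¬ H.Adj p q
  no_triangle : ∀ u v x y z, u ≠ v → ¬ H.Adj u v → H.Adj u x → H.Adj v x → H.Adj u y → H.Adj v y →
    H.Adj u z → H.Adj v z → H.Adj x y → H.Adj y z → H.Adj x z → False
  eq_of_not_adj : ∀ u v x y z, u ≠ v → ¬ H.Adj u v → H.Adj u x → H.Adj v x → H.Adj u y → H.Adj v y →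
    H.Adj u z → H.Adj v z → x ≠ y → x ≠ z → ¬ H.Adj x y → ¬ H.Adj x z → y = z

instance pyramid.decidableAdj : DecidableRel pyramid.Adj := fun a b =>
  match a, b with
  | none, none => inferInstanceAs (Decidable False)
  | none, some _ => inferInstanceAs (Decidable True)
  | some _, none => inferInstanceAs (Decidable True)
  | some i, some j => inferInstanceAs (Decidable ((cycleGraph 4).Adj i j))

set_option synthInstance.maxHeartbeats 200000 in
set_option synthInstance.maxSize 1000 in
theorem isIntervalLike_cycleGraph_four : (cycleGraph 4).IsIntervalLike := by
  constructor <;> decide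

theorem isIntervalLike_pyramid : pyramid.IsIntervalLike := by
  constructor <;> decide

theorem isIntervalLike_octahedron : octahedron.IsIntervalLike := by
  constructor
  · decide
  · rintro ⟨u, -⟩ ⟨v, -⟩ ⟨x, -⟩ ⟨y, -⟩ ⟨z, -⟩
    simp only [completeEquipartiteGraph_adj]
    intros
    omega
  · rintro ⟨u, u'⟩ ⟨v, v'⟩ ⟨x, x'⟩ ⟨y, y'⟩ ⟨z, z'⟩
    simp only [completeEquipartiteGraph_adj, ne_eq, Prod.mk.injEq]
    intros
    constructor <;> omega

theorem IsIntervalLike.of_iso {W W' : Type*} {H : SimpleGraph W} {H' : SimpleGraph W'}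
    (h : H'.IsIntervalLike) (e : H ≃g H') : H.IsIntervalLike := by
  constructor
  · intro u v huv hadj
    obtain ⟨p, q, h1, h2, h3, h4, h5, h6⟩ :=
      h.exists_square (e u) (e v) (by simpa using huv) (by rwa [e.map_adj_iff])
    refine ⟨e.symm p, e.symm q, ?_, ?_, ?_, ?_, by simpa using h5, ?_⟩ <;>
    · rw [← e.map_adj_iff]
      simpa only [RelIso.apply_symm_apply]
  · intro u v x y z
    have := h.no_triangle (e u) (e v) (e x) (e y) (e z)
    simpa only [e.map_adj_iff, ne_eq, e.injective.eq_iff] using this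
  · intro u v x y z
    have := h.eq_of_not_adj (e u) (e v) (e x) (e y) (e z)
    simpa only [e.map_adj_iff, ne_eq, e.injective.eq_iff] using this

/-- A connected graph with the positioning condition whose 2-intervals look like squares, pyramids
or octahedra. -/
structure IsBasisGraphLike {V : Type*} (G : SimpleGraph V) : Prop where
  conn : G.Connected
  intervals : ∀ u v, G.dist u v = 2 → (G.induce (G.interval u v)).IsIntervalLike
  positioning : ∀ v a b c d, G.Adj a b → G.Adj b c → G.Adj c d → G.Adj d a → a ≠ c → ¬ G.Adj a c →
    b ≠ d → ¬ G.Adj b d → G.dist v a + G.dist v c = G.dist v b + G.dist v d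

theorem IsBasisGraphLike.of_conditions {V : Type*} {G : SimpleGraph V} (hc : G.Connected)
    (hi : G.IntervalCondition) (hp : G.PositioningCondition) : G.IsBasisGraphLike := by
  refine ⟨hc, fun u v huv => ?_, fun v a b c d hab hbc hcd hda hac hac' hbd hbd' => ?_⟩
  · obtain ⟨⟨e⟩⟩ | ⟨⟨e⟩⟩ | ⟨⟨e⟩⟩ := hi u v huv
    · exact isIntervalLike_cycleGraph_four.of_iso e
    · exact isIntervalLike_pyramid.of_iso e
    · exact isIntervalLike_octahedron.of_iso e
  · let f : cycleGraph 4 ↪g G :=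
      { toFun := ![a, b, c, d]
        inj' := by
          have := hab.ne; have := hbc.ne; have := hcd.ne; have := hda.ne
          intro i j
          fin_cases i <;> fin_cases j <;> simp_all [eq_comm]
        map_rel_iff' := by
          have hca' : ¬ G.Adj c a := fun h => hac' h.symm
          have hdb' : ¬ G.Adj d b := fun h => hbd' h.symm
          intro i j
          fin_cases i <;> fin_cases j <;> first
            | exact iff_of_true hab (by decide)
            | exact iff_of_true hbc (by decide)
            | exact iff_of_true hcd (by decide)
            | exact iff_of_true hda (by decide)
            | exact iff_of_true hab.symm (by decide)
            | exact iff_of_true hbc.symm (by decide)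
            | exact iff_of_true hcd.symm (by decide)
            | exact iff_of_true hda.symm (by decide)
            | exact iff_of_false hac' (by decide)
            | exact iff_of_false hbd' (by decide)
            | exact iff_of_false hca' (by decide)
            | exact iff_of_false hdb' (by decide)
            | exact iff_of_false (G.irrefl) (by decide) }
    exact hp v f

namespace IsBasisGraphLike

variable {V : Type*} {G : SimpleGraph V}

theorem dist_eq_two (h : G.IsBasisGraphLike) {u v x : V} (huv : u ≠ v) (hadj : ¬ G.Adj u v)
    (hux : G.Adj u x) (hvx : G.Adj v x) : G.dist u v = 2 := by
  have h1 := h.conn.one_lt_dist_of_ne_of_not_adj huv hadj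
  have h2 := h.conn.dist_triangle (u := u) (v := x) (w := v)
  rw [dist_eq_one_iff_adj.2 hux, dist_eq_one_iff_adj.2 hvx.symm] at h2
  omega

theorem mem_interval {u v x : V} (huv : G.dist u v = 2) (hux : G.Adj u x) (hvx : G.Adj v x) :
    x ∈ G.interval u v := by
  simp [interval, huv, dist_eq_one_iff_adj.2 hux, dist_eq_one_iff_adj.2 hvx.symm]

theorem exists_square (h : G.IsBasisGraphLike) {u v : V} (huv : G.dist u v = 2) :
    ∃ p q, G.Adj u p ∧ G.Adj v p ∧ G.Adj u q ∧ G.Adj v q ∧ p ≠ q ∧ ¬ G.Adj p q := by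
  have hne : u ≠ v := by rintro rfl; simp at huv
  have hadj : ¬ G.Adj u v := by rw [← dist_eq_one_iff_adj]; omega
  obtain ⟨p, q, hpq⟩ := (h.intervals u v huv).exists_square ⟨u, by simp [interval]⟩
    ⟨v, by simp [interval]⟩ (fun t => hne congr($t.1)) hadj
  exact ⟨p, q, by simpa [Subtype.ext_iff] using hpq⟩

theorem no_triangle (h : G.IsBasisGraphLike) {u v x y z : V} (huv : u ≠ v) (hadj : ¬ G.Adj u v)
    (hux : G.Adj u x) (hvx : G.Adj v x) (huy : G.Adj u y) (hvy : G.Adj v y) (huz : G.Adj u z)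
    (hvz : G.Adj v z) (hxy : G.Adj x y) (hyz : G.Adj y z) (hxz : G.Adj x z) : False := by
  have hd := h.dist_eq_two huv hadj hux hvx
  exact (h.intervals u v hd).no_triangle ⟨u, by simp [interval]⟩ ⟨v, by simp [interval]⟩
    ⟨x, mem_interval hd hux hvx⟩ ⟨y, mem_interval hd huy hvy⟩ ⟨z, mem_interval hd huz hvz⟩
    (fun t => huv congr($t.1)) hadj hux hvx huy hvy huz hvz hxy hyz hxz

theorem eq_of_not_adj (h : G.IsBasisGraphLike) {u v x y z : V} (huv : u ≠ v) (hadj : ¬ G.Adj u v)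
    (hux : G.Adj u x) (hvx : G.Adj v x) (huy : G.Adj u y) (hvy : G.Adj v y) (huz : G.Adj u z)
    (hvz : G.Adj v z) (hxy : x ≠ y) (hxz : x ≠ z) (hxy' : ¬ G.Adj x y) (hxz' : ¬ G.Adj x z) :
    y = z := by
  have hd := h.dist_eq_two huv hadj hux hvx
  exact congrArg Subtype.val <| (h.intervals u v hd).eq_of_not_adj ⟨u, by simp [interval]⟩ ⟨v, by simp [interval]⟩
    ⟨x, mem_interval hd hux hvx⟩ ⟨y, mem_interval hd huy hvy⟩ ⟨z, mem_interval hd huz hvz⟩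
    (fun t => huv congr($t.1)) hadj hux hvx huy hvy huz hvz (fun t => hxy congr($t.1))
    (fun t => hxz congr($t.1))
    hxy' hxz'

/-- Two adjacent common neighbors of `u` and `v` are distinguished by a third one. -/
theorem exists_adj_iff_not_adj (h : G.IsBasisGraphLike) {u v x y : V} (huv : u ≠ v)
    (hadj : ¬ G.Adj u v) (hux : G.Adj u x) (hvx : G.Adj v x) (huy : G.Adj u y) (hvy : G.Adj v y)
    (hxy : G.Adj x y) : ∃ w, G.Adj u w ∧ G.Adj v w ∧ w ≠ x ∧ w ≠ y ∧ (G.Adj x w ↔ ¬ G.Adj y w) := by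
  obtain ⟨p, q, hup, hvp, huq, hvq, hpq, hpq'⟩ := h.exists_square (h.dist_eq_two huv hadj hux hvx)
  have hne := hxy.ne
  have key := fun a b c ha ha' hb hb' hc hc' =>
    h.eq_of_not_adj (u := u) (v := v) (x := a) (y := b) (z := c) huv hadj ha ha' hb hb' hc hc'
  have k1 := key p q x hup hvp huq hvq hux hvx hpq
  have k2 := key p q y hup hvp huq hvq huy hvy hpq
  have k3 := key q p x huq hvq hup hvp hux hvx hpq.symm
  have k4 := key q p y huq hvq hup hvp huy hvy hpq.symm
  have tri := h.no_triangle huv hadj hux hvx huy hvy hup hvp hxy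
  by_cases hpx : p = x
  · subst hpx
    exact ⟨q, huq, hvq, hpq.symm, by grind [G.adj_comm], by grind [G.adj_comm]⟩
  by_cases hpy : p = y
  · subst hpy
    exact ⟨q, huq, hvq, by grind [G.adj_comm], hpq.symm, by grind [G.adj_comm]⟩
  exact ⟨p, hup, hvp, hpx, hpy, by grind [G.adj_comm]⟩

/-- Otherwise `v`, `x`, `y` would be a triangle of common neighbors of the nonadjacent `a` and `b`.
-/
theorem no_diamond (h : G.IsBasisGraphLike) {v a b x y : V} (hva : G.Adj v a) (hvb : G.Adj v b)
    (hvx : G.Adj v x) (hvy : G.Adj v y) (hxy : G.Adj x y) (hxa : G.Adj x a) (hxb : G.Adj x b)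
    (hya : G.Adj y a) (hyb : G.Adj y b) (hab : a ≠ b) : G.Adj a b := by
  by_contra hab'
  exact h.no_triangle hab hab' hva.symm hvb.symm hxa.symm hxb.symm hya.symm hyb.symm hvx hxy hvy

/-- A common neighbor `w` of `a` and `b` is adjacent to exactly one of `v`, `x`, and is opposite the
other in a square through `a` and `b`. Seen from `c`, positioning gives `1 + d(c,w) = 2 + 2`,
whereas the one adjacent to `w` gives a path of length 2 from `c` to `w`. -/
theorem no_claw (h : G.IsBasisGraphLike) {v x a b c : V} (hva : G.Adj v a) (hvb : G.Adj v b)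
    (hvc : G.Adj v c) (hvx : G.Adj v x) (hxa : G.Adj x a) (hxb : G.Adj x b) (hxc : G.Adj x c)
    (hab : a ≠ b) (hac : a ≠ c) (hbc : b ≠ c) (hab' : ¬ G.Adj a b) (hac' : ¬ G.Adj a c)
    (hbc' : ¬ G.Adj b c) : False := by
  obtain ⟨w, haw, hbw, hwv, hwx, hw⟩ :=
    h.exists_adj_iff_not_adj hab hab' hva.symm hvb.symm hxa.symm hxb.symm hvx
  have hca : G.dist c a = 2 := h.dist_eq_two hac.symm (fun t => hac' t.symm) hvc.symm hva.symm
  have hcb : G.dist c b = 2 := h.dist_eq_two hbc.symm (fun t => hbc' t.symm) hvc.symm hvb.symm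
  have hcv := dist_eq_one_iff_adj.2 hvc.symm
  have hcx := dist_eq_one_iff_adj.2 hxc.symm
  by_cases hvw : G.Adj v w
  · have := h.positioning c a x b w hxa.symm hxb hbw haw.symm hab hab' hwx.symm (hw.1 hvw)
    have := h.conn.dist_triangle (u := c) (v := v) (w := w)
    rw [dist_eq_one_iff_adj.2 hvw] at this
    omega
  · have := h.positioning c a v b w hva.symm hvb hbw haw.symm hab hab' hwv.symm hvw
    have := h.conn.dist_triangle (u := c) (v := x) (w := w)
    rw [dist_eq_one_iff_adj.2 (by tauto : G.Adj x w)] at this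
    omega

end IsBasisGraphLike

end SimpleGraph

/-! ### Links contain no odd holes. -/

namespace SimpleGraph

variable {V : Type*} {G : SimpleGraph V}

/-- `h 0, …, h (n - 1)` is an induced cycle of length `n` in the neighborhood of `v`. -/
structure IsLinkHole (G : SimpleGraph V) (v : V) (n : ℕ) (h : ℕ → V) : Prop where
  adj_center : ∀ i, i < n → G.Adj v (h i)
  ne : ∀ i j, i < j → j < n → h i ≠ h j
  adj_iff : ∀ i j, i < j → j < n → (G.Adj (h i) (h j) ↔ j = i + 1 ∨ (i = 0 ∧ j + 1 = n))

namespace IsLinkHole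

variable {v : V} {n : ℕ} {h : ℕ → V}

theorem rotate (H : G.IsLinkHole v n h) {c : ℕ} (hc : c < n) :
    G.IsLinkHole v n fun i => h ((i + c) % n) := by
  have hmod : ∀ i, i < n → (i + c) % n = if i + c < n then i + c else i + c - n := by
    intro i hi
    split_ifs with hlt
    · exact Nat.mod_eq_of_lt hlt
    · rw [Nat.mod_eq_sub_mod (by omega), Nat.mod_eq_of_lt (by omega)]
  refine ⟨fun i hi => H.adj_center _ (Nat.mod_lt _ (by omega)), fun i j hij hj => ?_,
    fun i j hij hj => ?_⟩
  · simp only [hmod i (by omega), hmod j hj]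
    split_ifs
    · exact H.ne _ _ (by omega) (by omega)
    · exact (H.ne _ _ (by omega) (by omega)).symm
    · omega
    · exact H.ne _ _ (by omega) (by omega)
  · simp only [hmod i (by omega), hmod j hj]
    split_ifs
    · rw [H.adj_iff _ _ (by omega) (by omega)]; omega
    · rw [G.adj_comm, H.adj_iff _ _ (by omega) (by omega)]; omega
    · omega
    · rw [H.adj_iff _ _ (by omega) (by omega)]; omega

/-- A vertex of the link joined to the two ends of an arc closes it up to a hole. -/
theorem arc (H : G.IsLinkHole v n h) {a : V} (hva : G.Adj v a) (ha : ∀ i, i < n → a ≠ h i)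
    {s t : ℕ} (hst : s + 2 ≤ t) (ht : t < n) (hst' : ¬ (s = 0 ∧ t + 1 = n)) (hs : G.Adj a (h s))
    (hat : G.Adj a (h t)) (hi : ∀ i, s < i → i < t → ¬ G.Adj a (h i)) :
    G.IsLinkHole v (t - s + 2) fun i => if i = 0 then a else h (s + i - 1) := by
  refine ⟨fun i hi => ?_, fun i j hij hj => ?_, fun i j hij hj => ?_⟩
  · split_ifs
    · exact hva
    · exact H.adj_center _ (by omega)
  · simp only [show j ≠ 0 by omega, if_false]
    split_ifs
    · exact ha _ (by omega)
    · exact H.ne _ _ (by omega) (by omega)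
  · simp only [show j ≠ 0 by omega, if_false]
    split_ifs with h0
    · constructor
      · intro hadj
        by_contra hne
        exact hi (s + j - 1) (by omega) (by omega) hadj
      · rintro (hj | hj)
        · rwa [show s + j - 1 = s by omega]
        · rwa [show s + j - 1 = t by omega]
    · rw [H.adj_iff _ _ (by omega) (by omega)]
      omega

end IsLinkHole

namespace IsBasisGraphLike

theorem dist_linkHole (hG : G.IsBasisGraphLike) {v : V} {n : ℕ} {h : ℕ → V}
    (H : G.IsLinkHole v n h) {i j : ℕ} (hij : i < j) (hj : j < n) :
    G.dist (h i) (h j) = if j = i + 1 ∨ (i = 0 ∧ j + 1 = n) then 1 else 2 := by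
  split_ifs with hc
  · exact dist_eq_one_iff_adj.2 ((H.adj_iff i j hij hj).2 hc)
  · exact hG.dist_eq_two (H.ne i j hij hj) (fun t => hc ((H.adj_iff i j hij hj).1 t))
      (H.adj_center i (by omega)).symm (H.adj_center j hj).symm

section chord

variable {v : V} {n : ℕ} {h : ℕ → V}

/-- By `no_diamond` and `no_claw`, the neighbors of `a` on the hole are exactly two disjoint edges
of it. Through `a`, the two arcs between these edges close up to holes of lengths `q + 2` and `n -
q`. The sum `n + 2` is odd, so one of them is a shorter odd hole. -/
theorem no_chord_of_adj_last (hG : G.IsBasisGraphLike) (hn : Odd n)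
    (hmin : ∀ m, 5 ≤ m → m < n → Odd m → ∀ h', ¬ G.IsLinkHole v m h')
    (H : G.IsLinkHole v n h) {a : V} (hva : G.Adj v a) (ha : ∀ i, i < n → a ≠ h i)
    (h0 : G.Adj a (h 0)) (hlast : G.Adj a (h (n - 1))) {j : ℕ} (h2j : 2 ≤ j) (hj : j + 3 ≤ n)
    (haj : G.Adj a (h j)) : False := by
  have hvh := H.adj_center
  have hA := H.adj_iff
  have not_adj_both : ∀ i, i + 2 < n → G.Adj a (h i) → G.Adj a (h (i + 1)) →
      G.Adj a (h (i + 2)) → False := by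
    intro i hi hi0 hi1 hi2
    have := hG.no_diamond (hvh i (by omega)) (hvh (i + 2) (by omega)) hva (hvh (i + 1) (by omega))
      hi1 hi0 hi2 ((hA _ _ (by omega) (by omega)).2 (by omega)).symm
      ((hA (i + 1) (i + 2) (by omega) (by omega)).2 (by omega)) (H.ne _ _ (by omega) (by omega))
    rw [hA _ _ (by omega) (by omega)] at this
    omega
  have not_adj_one : ¬ G.Adj a (h 1) := by
    intro h1
    have := hG.no_diamond (hvh 1 (by omega)) (hvh (n - 1) (by omega)) hva (hvh 0 (by omega))
      h0 h1 hlast ((hA 0 1 (by omega) (by omega)).2 (by omega))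
      ((hA 0 (n - 1) (by omega) (by omega)).2 (by omega)) (H.ne _ _ (by omega) (by omega))
    rw [hA _ _ (by omega) (by omega)] at this
    omega
  have not_adj_penultimate : ¬ G.Adj a (h (n - 2)) := by
    intro h1
    have := hG.no_diamond (hvh 0 (by omega)) (hvh (n - 2) (by omega)) hva (hvh (n - 1) (by omega))
      hlast h0 h1 ((hA 0 (n - 1) (by omega) (by omega)).2 (by omega)).symm
      ((hA (n - 2) (n - 1) (by omega) (by omega)).2 (by omega)).symm
      (H.ne _ _ (by omega) (by omega))
    rw [hA _ _ (by omega) (by omega)] at this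
    omega
  -- Without such an edge, `h j` would be the center of a claw with leaves `a`, `h (j - 1)` and `h
  -- (j + 1)`.
  obtain ⟨q, h2q, hq, haq, haq'⟩ : ∃ q, 2 ≤ q ∧ q + 4 ≤ n ∧ G.Adj a (h q) ∧ G.Adj a (h (q + 1)) := by
    by_contra hcon
    have hj1 : ¬ G.Adj a (h (j + 1)) := by
      intro hadj
      by_cases hj4 : j + 4 ≤ n
      · exact hcon ⟨j, h2j, hj4, haj, hadj⟩
      · exact not_adj_penultimate (by rwa [show n - 2 = j + 1 by omega])
    have hj2 : ¬ G.Adj a (h (j - 1)) := by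
      intro hadj
      by_cases hj4 : 3 ≤ j
      · exact hcon ⟨j - 1, by omega, by omega, hadj, by rwa [show j - 1 + 1 = j by omega]⟩
      · exact not_adj_one (by rwa [show 1 = j - 1 by omega])
    refine hG.no_claw (hvh (j - 1) (by omega)) (hvh (j + 1) (by omega)) hva (hvh j (by omega))
      ((hA (j - 1) j (by omega) (by omega)).2 (by omega)).symm
      ((hA _ _ (by omega) (by omega)).2 (by omega)) haj.symm (H.ne _ _ (by omega) (by omega))
      (ha _ (by omega)).symm (ha _ (by omega)).symm ?_ (fun t => hj2 t.symm) (fun t => hj1 t.symm)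
    rw [hA _ _ (by omega) (by omega)]
    omega
  have others : ∀ r, 0 < r → r + 1 < n → G.Adj a (h r) → r = q ∨ r = q + 1 := by
    intro r hr0 hrn har
    by_contra hne
    have hr1 : r ≠ 1 := by rintro rfl; exact not_adj_one har
    have hr2 : r ≠ n - 2 := by rintro rfl; exact not_adj_penultimate har
    have hr3 : r + 1 ≠ q := by
      rintro rfl
      exact not_adj_both r (by omega) har haq haq'
    have hr4 : r ≠ q + 2 := by
      rintro rfl
      exact not_adj_both q (by omega) haq haq' har
    have h0q : ¬ G.Adj (h 0) (h q) := by rw [hA _ _ (by omega) (by omega)]; omega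
    have h0r : ¬ G.Adj (h 0) (h r) := by rw [hA _ _ (by omega) (by omega)]; omega
    have hqr : h q ≠ h r ∧ ¬ G.Adj (h q) (h r) := by
      rcases lt_trichotomy q r with hlt | rfl | hlt
      · rw [hA _ _ hlt (by omega)]
        exact ⟨H.ne _ _ hlt (by omega), by omega⟩
      · omega
      · rw [G.adj_comm, hA _ _ hlt (by omega)]
        exact ⟨(H.ne _ _ hlt (by omega)).symm, by omega⟩
    exact hG.no_claw (hvh 0 (by omega)) (hvh q (by omega)) (hvh r (by omega)) hva h0 haq har
      (H.ne _ _ (by omega) (by omega)) (H.ne _ _ (by omega) (by omega)) hqr.1 h0q h0r hqr.2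
  have hole1 := H.arc hva ha (s := 0) (t := q) (by omega) (by omega) (by omega) h0 haq
    (fun i h1 h2 h3 => by have := others i h1 (by omega) h3; omega)
  have hole2 := H.arc hva ha (s := q + 1) (t := n - 1) (by omega) (by omega) (by omega) haq' hlast
    (fun i h1 h2 h3 => by have := others i (by omega) (by omega) h3; omega)
  obtain ⟨k, rfl⟩ := hn
  rcases Nat.even_or_odd q with ⟨l, hl⟩ | ⟨l, hl⟩
  · exact hmin _ (by omega) (by omega) ⟨k - l, by omega⟩ _ hole2
  · exact hmin _ (by omega) (by omega) ⟨l + 1, by omega⟩ _ hole1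

/-- To avoid a claw at `h 0`, `a` is adjacent to a second end of a hole edge at `h 0`; a rotation
puts this edge at the closing position. -/
theorem no_chord_of_adj_zero (hG : G.IsBasisGraphLike) (hn : Odd n)
    (hmin : ∀ m, 5 ≤ m → m < n → Odd m → ∀ h', ¬ G.IsLinkHole v m h')
    (H : G.IsLinkHole v n h) {a : V} (hva : G.Adj v a) (ha : ∀ i, i < n → a ≠ h i)
    (h0 : G.Adj a (h 0)) {j : ℕ} (h2j : 2 ≤ j) (hj : j + 2 ≤ n) (haj : G.Adj a (h j)) : False := by
  have hvh := H.adj_center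
  have hA := H.adj_iff
  have key : G.Adj a (h 1) ∨ G.Adj a (h (n - 1)) := by
    by_contra! hcon
    refine hG.no_claw (hvh 1 (by omega)) (hvh (n - 1) (by omega)) hva (hvh 0 (by omega))
      ((hA _ _ (by omega) (by omega)).2 (by omega)) ((hA _ _ (by omega) (by omega)).2 (by omega))
      h0.symm ?_ (ha _ (by omega)).symm (ha _ (by omega)).symm ?_ (fun t => hcon.1 t.symm)
      (fun t => hcon.2 t.symm)
    · exact H.ne _ _ (by obtain ⟨k, rfl⟩ := hn; omega) (by omega)
    · rw [hA _ _ (by obtain ⟨k, rfl⟩ := hn; omega) (by omega)]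
      obtain ⟨k, rfl⟩ := hn
      omega
  have hmod : ∀ i, i < n → (i + 1) % n = if i + 1 < n then i + 1 else 0 := by
    intro i hi
    split_ifs with hlt
    · exact Nat.mod_eq_of_lt hlt
    · rw [show i + 1 = n by omega, Nat.mod_self]
  rcases key with h1 | hlast
  · have hj3 : j ≠ 2 := by
      rintro rfl
      have := hG.no_diamond (hvh 0 (by omega)) (hvh 2 (by omega)) hva (hvh 1 (by omega))
        h1 h0 haj ((hA 0 1 (by omega) (by omega)).2 (by omega)).symm
        ((hA 1 2 (by omega) (by omega)).2 (by omega)) (H.ne _ _ (by omega) (by omega))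
      rw [hA _ _ (by omega) (by omega)] at this
      obtain ⟨k, rfl⟩ := hn
      omega
    refine hG.no_chord_of_adj_last hn hmin (H.rotate (c := 1) (by omega)) hva
      (fun i hi => ha _ (Nat.mod_lt _ (by omega))) (j := j - 1) ?_ ?_ (by omega) (by omega) ?_
    · simpa [hmod 0 (by omega), show 1 < n by omega] using h1
    · rw [hmod _ (by omega), if_neg (by omega)]
      exact h0
    · rw [hmod _ (by omega), if_pos (by omega), show j - 1 + 1 = j by omega]
      exact haj
  · have hj3 : j + 2 ≠ n := by
      rintro rfl
      have := hG.no_diamond (hvh 0 (by omega)) (hvh j (by omega)) hva (hvh (j + 1) (by omega))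
        hlast h0 haj ((hA 0 (j + 1) (by omega) (by omega)).2 (by omega)).symm
        ((hA j (j + 1) (by omega) (by omega)).2 (by omega)).symm (H.ne _ _ (by omega) (by omega))
      rw [hA _ _ (by omega) (by omega)] at this
      obtain ⟨k, hk⟩ := hn
      omega
    exact hG.no_chord_of_adj_last hn hmin H hva ha h0 hlast h2j (by omega) haj

theorem no_chord (hG : G.IsBasisGraphLike) (hn : Odd n)
    (hmin : ∀ m, 5 ≤ m → m < n → Odd m → ∀ h', ¬ G.IsLinkHole v m h')
    (H : G.IsLinkHole v n h) {a : V} (hva : G.Adj v a) {i j : ℕ} (hij : i < j) (hj : j < n)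
    (hij' : ¬ G.Adj (h i) (h j)) (hai : G.Adj a (h i)) (haj : G.Adj a (h j)) :
    ∃ k, k < n ∧ a = h k := by
  by_contra! ha
  rw [H.adj_iff i j hij hj] at hij'
  refine hG.no_chord_of_adj_zero hn hmin (H.rotate (c := i) (by omega)) hva
      (fun i hi => ha _ (Nat.mod_lt _ (by omega))) (j := j - i) ?_ (by omega) (by omega) ?_
  · rw [zero_add, Nat.mod_eq_of_lt (by omega)]
    exact hai
  · rw [show j - i + i = j by omega, Nat.mod_eq_of_lt hj]
    exact haj

/-- The two neighbors of `h 0` on a minimal odd hole are opposite in a square through `v`, whose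
fourth vertex is adjacent to `h 0`. -/
theorem exists_opposite_center (hG : G.IsBasisGraphLike) (h5 : 5 ≤ n) (hn : Odd n)
    (hmin : ∀ m, 5 ≤ m → m < n → Odd m → ∀ h', ¬ G.IsLinkHole v m h')
    (H : G.IsLinkHole v n h) : ∃ w, G.Adj (h 1) w ∧ G.Adj (h (n - 1)) w ∧ G.Adj (h 0) w ∧
      w ≠ v ∧ ¬ G.Adj v w := by
  have hvh := H.adj_center
  have hA := H.adj_iff
  have hne := H.ne 1 (n - 1) (by omega) (by omega)
  have hnadj : ¬ G.Adj (h 1) (h (n - 1)) := by rw [hA _ _ (by omega) (by omega)]; omega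
  obtain ⟨w, h1, h2, h3, h4, h6⟩ := hG.exists_adj_iff_not_adj hne hnadj (hvh 1 (by omega)).symm
    (hvh (n - 1) (by omega)).symm ((hA 0 1 (by omega) (by omega)).2 (by omega)).symm
    ((hA 0 (n - 1) (by omega) (by omega)).2 (by omega)).symm (hvh 0 (by omega))
  -- Otherwise `w` lies on the hole by `no_chord`, but `h 0` is its only vertex adjacent to both `h
  -- 1` and `h (n - 1)`.
  have hvw : ¬ G.Adj v w := by
    intro hvw
    obtain ⟨k, hk, rfl⟩ := hG.no_chord hn hmin H hvw (i := 1) (j := n - 1) (by omega) (by omega)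
      hnadj h1.symm h2.symm
    have hk0 : k ≠ 0 := by rintro rfl; exact h4 rfl
    have hk1 : k ≠ 1 := by rintro rfl; exact h1.ne rfl
    have hk2 : k ≠ n - 1 := by rintro rfl; exact h2.ne rfl
    rw [hA _ _ (by omega) hk] at h1
    rw [G.adj_comm, hA _ _ (by omega) (by omega)] at h2
    omega
  exact ⟨w, h1, h2, by tauto, h3, hvw⟩

/-- In a square on `h 0` and `h j`, one of the other two vertices is not adjacent to `v`: by
`no_chord`, those adjacent to `v` lie on the hole, which has at most one common neighbor of `h 0`
and `h j`, since `n ≠ 4`. -/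
theorem exists_opposite (hG : G.IsBasisGraphLike) (h5 : 5 ≤ n) (hn : Odd n)
    (hmin : ∀ m, 5 ≤ m → m < n → Odd m → ∀ h', ¬ G.IsLinkHole v m h')
    (H : G.IsLinkHole v n h) {j : ℕ} (h2j : 2 ≤ j) (hj : j + 2 ≤ n) :
    ∃ w, G.Adj (h 0) w ∧ G.Adj (h j) w ∧ w ≠ v ∧ ¬ G.Adj v w := by
  have hvh := H.adj_center
  have hA := H.adj_iff
  have hne := H.ne 0 j (by omega) (by omega)
  have hnadj : ¬ G.Adj (h 0) (h j) := by rw [hA _ _ (by omega) (by omega)]; omega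
  obtain ⟨p, q, h0p, hjp, h0q, hjq, hpq, hpq'⟩ := hG.exists_square
    (hG.dist_eq_two hne hnadj (hvh 0 (by omega)).symm (hvh j (by omega)).symm)
  have key : ∀ a, G.Adj v a → G.Adj (h 0) a → G.Adj (h j) a →
      (a = h 1 ∧ j = 2) ∨ (a = h (n - 1) ∧ j + 2 = n) := by
    intro a hva h0a hja
    obtain ⟨k, hk, rfl⟩ := hG.no_chord hn hmin H hva (i := 0) (j := j) (by omega) (by omega)
      hnadj h0a.symm hja.symm
    have hk0 : k ≠ 0 := by rintro rfl; exact h0a.ne rfl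
    rw [hA _ _ (by omega) hk] at h0a
    rcases lt_trichotomy k j with hlt | rfl | hlt
    · rw [G.adj_comm, hA _ _ hlt (by omega)] at hja
      left
      exact ⟨by rw [show k = 1 by omega], by omega⟩
    · exact absurd rfl hja.ne
    · rw [hA _ _ hlt hk] at hja
      right
      exact ⟨by rw [show k = n - 1 by omega], by omega⟩
  by_cases hvp : v = p
  · subst hvp
    exact ⟨q, h0q, hjq, hpq.symm, hpq'⟩
  by_cases hvq : v = q
  · subst hvq
    exact ⟨p, h0p, hjp, hpq, fun t => hpq' t.symm⟩
  by_cases hvp' : G.Adj v p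
  · by_cases hvq' : G.Adj v q
    · exfalso
      rcases key p hvp' h0p hjp with ⟨rfl, h1⟩ | ⟨rfl, h1⟩ <;>
        rcases key q hvq' h0q hjq with ⟨rfl, h2⟩ | ⟨rfl, h2⟩
      · exact hpq rfl
      · obtain ⟨k, rfl⟩ := hn; omega
      · obtain ⟨k, rfl⟩ := hn; omega
      · exact hpq rfl
    · exact ⟨q, h0q, hjq, fun t => hvq t.symm, hvq'⟩
  · exact ⟨p, h0p, hjp, fun t => hvp t.symm, hvp'⟩

/-- Replacing a hole in the link of `v` by a shorter one in the link of its vertex `h 0`. -/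
theorem isLinkHole_pivot (hG : G.IsBasisGraphLike) (h5 : 5 ≤ n) (H : G.IsLinkHole v n h)
    {w₀ : V} (h1w₀ : G.Adj (h 1) w₀) (hlw₀ : G.Adj (h (n - 1)) w₀) (h0w₀ : G.Adj (h 0) w₀)
    (hw₀v : w₀ ≠ v) (hvw₀ : ¬ G.Adj v w₀) {w : ℕ → V}
    (h0w : ∀ j, 2 ≤ j → j + 2 ≤ n → G.Adj (h 0) (w j))
    (hjw : ∀ j, 2 ≤ j → j + 2 ≤ n → G.Adj (h j) (w j))
    (hwv : ∀ j, 2 ≤ j → j + 2 ≤ n → w j ≠ v) (hvw : ∀ j, 2 ≤ j → j + 2 ≤ n → ¬ G.Adj v (w j)) :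
    G.IsLinkHole (h 0) (n - 2) fun i => if i = 0 then w₀ else w (i + 1) := by
  have hvh := H.adj_center
  have hA := H.adj_iff
  have pos : ∀ k j, 2 ≤ j → j + 2 ≤ n →
      G.dist k v + G.dist k (w j) = G.dist k (h 0) + G.dist k (h j) := by
    intro k j h2 hj
    have hne := H.ne 0 j (by omega) (by omega)
    have hnadj : ¬ G.Adj (h 0) (h j) := by rw [hA _ _ (by omega) (by omega)]; omega
    exact hG.positioning k _ _ _ _ (hvh 0 (by omega)) (h0w j h2 hj) (hjw j h2 hj).symm
      (hvh j (by omega)).symm (hwv j h2 hj).symm (hvw j h2 hj) hne hnadj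
  have pos₀ : ∀ k, G.dist k v + G.dist k w₀ = G.dist k (h 1) + G.dist k (h (n - 1)) := by
    intro k
    have hne := H.ne 1 (n - 1) (by omega) (by omega)
    have hnadj : ¬ G.Adj (h 1) (h (n - 1)) := by rw [hA _ _ (by omega) (by omega)]; omega
    exact hG.positioning k _ _ _ _ (hvh 1 (by omega)) h1w₀ hlw₀.symm
      (hvh (n - 1) (by omega)).symm hw₀v.symm hvw₀ hne hnadj
  have hw2 : ∀ j, 2 ≤ j → j + 2 ≤ n → G.dist (w j) v = 2 := fun j h2 hj =>
    hG.dist_eq_two (hwv j h2 hj) (fun t => hvw j h2 hj t.symm) (h0w j h2 hj).symm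
      (hvh 0 (by omega))
  have hw₀2 : G.dist w₀ v = 2 :=
    hG.dist_eq_two hw₀v (fun t => hvw₀ t.symm) h0w₀.symm (hvh 0 (by omega))
  have hd : ∀ i, i < n → G.dist (h i) v = 1 := fun i hi =>
    dist_eq_one_iff_adj.2 (hvh i hi).symm
  have hd0 : ∀ j, 2 ≤ j → j + 2 ≤ n → G.dist (h j) (h 0) = 2 := by
    intro j h2 hj
    rw [dist_comm, hG.dist_linkHole H (by omega) (by omega), if_neg (by omega)]
  -- Two applications of positioning give `d(w p, w q) = d(h p, h q)`.
  have dist_w : ∀ p q, 2 ≤ p → p < q → q + 2 ≤ n →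
      G.dist (w p) (w q) = if q = p + 1 then 1 else 2 := by
    intro p q h2 hpq hq
    have e1 := pos (w p) q (by omega) hq
    have e2 := pos (h q) p h2 (by omega)
    have e3 := hw2 p h2 (by omega)
    have e4 : G.dist (w p) (h 0) = 1 := dist_eq_one_iff_adj.2 (h0w p h2 (by omega)).symm
    have e5 := hd q (by omega)
    have e6 := hd0 q (by omega) hq
    have e7 := hG.dist_linkHole H hpq (by omega)
    rw [dist_comm] at e7
    rw [dist_comm (u := h q) (v := w p)] at e2
    split_ifs at e7 ⊢ <;> omega
  -- Here positioning gives `d(w₀, w q) = d(h 1, h q) + d(h q, h (n - 1)) - 2`.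
  have dist_w₀ : ∀ q, 2 ≤ q → q + 2 ≤ n →
      G.dist w₀ (w q) = if q = 2 ∨ q + 2 = n then 1 else 2 := by
    intro q h2 hq
    have e1 := pos w₀ q h2 hq
    have e2 := pos₀ (h q)
    have e4 : G.dist w₀ (h 0) = 1 := dist_eq_one_iff_adj.2 h0w₀.symm
    have e5 := hd q (by omega)
    have e7 := hG.dist_linkHole H (i := 1) (j := q) (by omega) (by omega)
    have e8 := hG.dist_linkHole H (i := q) (j := n - 1) (by omega) (by omega)
    rw [dist_comm] at e7
    rw [dist_comm (u := h q) (v := w₀)] at e2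
    split_ifs at e7 e8 ⊢ <;> omega
  refine ⟨fun i hi => ?_, fun i j hij hj => ?_, fun i j hij hj => ?_⟩
  · split_ifs
    · exact h0w₀
    · exact h0w _ (by omega) (by omega)
  · simp only [show j ≠ 0 by omega, if_false]
    split_ifs
    · intro heq
      have := dist_w₀ (j + 1) (by omega) (by omega)
      rw [heq, dist_self] at this
      split_ifs at this
    · intro heq
      have := dist_w (i + 1) (j + 1) (by omega) (by omega) (by omega)
      rw [heq, dist_self] at this
      split_ifs at this
  · simp only [show j ≠ 0 by omega, if_false]
    split_ifs with h0
    · rw [← dist_eq_one_iff_adj, dist_w₀ (j + 1) (by omega) (by omega)]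
      split_ifs <;> omega
    · rw [← dist_eq_one_iff_adj, dist_w (i + 1) (j + 1) (by omega) (by omega) (by omega)]
      split_ifs <;> omega

end chord

/-- Links contain no odd holes. -/
theorem not_isLinkHole (hG : G.IsBasisGraphLike) (n : ℕ) (h5 : 5 ≤ n) (hn : Odd n) (v : V)
    (h : ℕ → V) : ¬ G.IsLinkHole v n h := by
  induction n using Nat.strong_induction_on generalizing v h with
  | _ n ih =>
  intro H
  have hmin : ∀ m, 5 ≤ m → m < n → Odd m → ∀ h', ¬ G.IsLinkHole v m h' :=
    fun m h5 hm hodd h' => ih m hm h5 hodd v h'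
  obtain ⟨w₀, h1w₀, hlw₀, h0w₀, hw₀v, hvw₀⟩ := hG.exists_opposite_center h5 hn hmin H
  obtain ⟨w₂, h2w₂, h0w₂, h1w₂, hw₂v, hvw₂⟩ :=
    hG.exists_opposite_center h5 hn hmin (H.rotate (c := 1) (by omega))
  simp only [Nat.reduceAdd, Nat.mod_eq_of_lt (show 2 < n by omega), show n - 1 + 1 = n by omega,
    Nat.mod_self, zero_add, Nat.mod_eq_of_lt (show 1 < n by omega)] at h2w₂ h0w₂ h1w₂
  have : ∀ j, ∃ w, 2 ≤ j → j + 2 ≤ n →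
      G.Adj (h 0) w ∧ G.Adj (h j) w ∧ w ≠ v ∧ ¬ G.Adj v w := by
    intro j
    by_cases hj : 2 ≤ j ∧ j + 2 ≤ n
    · obtain ⟨w, hw⟩ := hG.exists_opposite h5 hn hmin H hj.1 hj.2
      exact ⟨w, fun _ _ => hw⟩
    · exact ⟨v, fun h1 h2 => absurd ⟨h1, h2⟩ hj⟩
  choose w' hw' using this
  -- The choice at `j = 2` matters only when `n = 5`, where `w 2` has to be adjacent to `h 1`.
  let w : ℕ → V := fun j => if j = 2 then w₂ else w' j
  have hw : ∀ j, 2 ≤ j → j + 2 ≤ n →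
      G.Adj (h 0) (w j) ∧ G.Adj (h j) (w j) ∧ w j ≠ v ∧ ¬ G.Adj v (w j) := by
    intro j h2 hj
    by_cases hj2 : j = 2
    · subst hj2
      exact ⟨h0w₂, h2w₂, hw₂v, hvw₂⟩
    · simp only [w, hj2, if_false]
      exact hw' j h2 hj
  have H' := hG.isLinkHole_pivot h5 H h1w₀ hlw₀ h0w₀ hw₀v hvw₀ (w := w)
    (fun j h1 h2 => (hw j h1 h2).1) (fun j h1 h2 => (hw j h1 h2).2.1)
    (fun j h1 h2 => (hw j h1 h2).2.2.1) (fun j h1 h2 => (hw j h1 h2).2.2.2)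
  by_cases h7 : 7 ≤ n
  · refine ih (n - 2) (by omega) (by omega) ?_ _ _ H'
    obtain ⟨k, rfl⟩ := hn
    exact ⟨k - 1, by omega⟩
  -- The pivoted hole is now only a triangle. In the link of `h 0`, both `h 1` and `w 3` are
  -- adjacent to the adjacent vertices `w₀` and `w₂`, hence to each other, but positioning puts them
  -- at distance 2.
  have hn5 : n = 5 := by obtain ⟨k, rfl⟩ := hn; omega
  subst hn5
  have a1 : G.Adj w₀ w₂ := (H'.adj_iff 0 1 (by omega) (by omega)).2 (by omega)
  have a2 : G.Adj w₀ (w 3) := (H'.adj_iff 0 2 (by omega) (by omega)).2 (by omega)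
  have a3 : G.Adj w₂ (w 3) := (H'.adj_iff 1 2 (by omega) (by omega)).2 (by omega)
  have d0 := hG.dist_linkHole H (i := 0) (j := 1) (by omega) (by omega)
  have d1 := hG.dist_linkHole H (i := 1) (j := 3) (by omega) (by omega)
  have d2 := dist_eq_one_iff_adj.2 (H.adj_center 1 (by omega)).symm
  obtain ⟨b1, b2, b3, b4⟩ := hw 3 (by omega) (by omega)
  have d3 := hG.positioning (h 1) _ _ _ _ (H.adj_center 0 (by omega)) b1 b2.symm
      (H.adj_center 3 (by omega)).symm b3.symm b4 (H.ne 0 3 (by omega) (by omega))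
      (by rw [H.adj_iff _ _ (by omega) (by omega)]; omega)
  rw [dist_comm] at d0
  norm_num at d0 d1
  have d4 : G.dist (h 1) (w 3) = 2 := by
    rw [dist_eq_one_iff_adj.2 d0] at d3
    omega
  have h1w3 : h 1 ≠ w 3 := by intro heq; rw [heq, dist_self] at d4; omega
  have := hG.no_diamond ((H.adj_iff 0 1 (by omega) (by omega)).2 (by omega)) b1 h0w₀ h0w₂ a1
    h1w₀.symm a2 h1w₂.symm a3 h1w3
  rw [← dist_eq_one_iff_adj] at this
  omega

end IsBasisGraphLike

end SimpleGraph

/-! ### Links are line graphs of bipartite graphs. -/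

namespace SimpleGraph

variable {V : Type*} {G : SimpleGraph V}

/-- A graph that is not bipartite contains an odd cycle. -/
theorem exists_odd_cycle_of_not_colorable_two {α : Type*} {Γ : SimpleGraph α}
    (hΓ : ¬ Γ.Colorable 2) : ∃ (n : ℕ) (s : ℕ → α), Odd n ∧ s n = s 0 ∧
      (∀ i, i < n → Γ.Adj (s i) (s (i + 1))) ∧ ∀ i j, i < j → j < n → s i ≠ s j := by
  classical
  have hex : ∃ n, ∃ s : ℕ → α, Odd n ∧ s n = s 0 ∧ ∀ i, i < n → Γ.Adj (s i) (s (i + 1)) := by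
    rw [two_colorable_iff_forall_loop_even] at hΓ
    push Not at hΓ
    obtain ⟨u, w, hw⟩ := hΓ
    exact ⟨w.length, w.getVert, by simpa using hw, by simp, fun i hi => w.adj_getVert_succ hi⟩
  obtain ⟨s, hodd, hloop, hadj⟩ := Nat.find_spec hex
  refine ⟨_, s, hodd, hloop, hadj, fun i j hij hj heq => ?_⟩
  -- In a shortest odd closed walk, a repeated vertex would split off two shorter closed walks, one
  -- of them odd.
  set n := Nat.find hex
  have h1 : ¬ Odd (j - i) := by
    intro ho
    refine Nat.find_min hex (m := j - i) (by omega) ⟨fun k => s (i + k), ho, ?_, fun k hk => ?_⟩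
    · simp only [show i + (j - i) = j by omega, heq, add_zero]
    · exact hadj (i + k) (by omega)
  have h2 : Odd (n - (j - i)) := by
    rw [Nat.not_odd_iff_even] at h1
    exact Nat.Odd.sub_even (by omega) hodd h1
  refine Nat.find_min hex (m := n - (j - i)) (by omega)
    ⟨fun k => if k ≤ i then s k else s (k + (j - i)), h2, ?_, fun k hk => ?_⟩
  · simp only [show ¬ n - (j - i) ≤ i by omega, if_false, Nat.zero_le, if_true]
    rw [show n - (j - i) + (j - i) = n by omega, hloop]
  · rcases lt_trichotomy k i with hlt | rfl | hlt
    · simp only [hlt.le, show k + 1 ≤ i by omega, if_true]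
      exact hadj k (by omega)
    · simp only [le_refl, if_true, show ¬ k + 1 ≤ k by omega, if_false, heq]
      rw [show k + 1 + (j - k) = j + 1 by omega]
      exact hadj j hj
    · simp only [show ¬ k ≤ i by omega, show ¬ k + 1 ≤ i by omega, if_false]
      rw [show k + 1 + (j - i) = k + (j - i) + 1 by omega]
      exact hadj _ (by omega)

/-- The common closed neighborhood of `a` and `b` in the link of `v`. -/
def linkClique (G : SimpleGraph V) (v a b : V) : Set V :=
  {x | G.Adj v x ∧ (x = a ∨ G.Adj x a) ∧ (x = b ∨ G.Adj x b)}

/-- The sets `linkClique G v a b` for adjacent `a`, `b` in the link of `v`. -/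
def IsLinkClique (G : SimpleGraph V) (v : V) (S : Set V) : Prop :=
  ∃ a b, G.Adj v a ∧ G.Adj v b ∧ G.Adj a b ∧ S = G.linkClique v a b

/-- The intersection graph of the cliques of the link of `v`. -/
def linkCliqueGraph (G : SimpleGraph V) (v : V) : SimpleGraph (Set V) where
  Adj S T := S ≠ T ∧ G.IsLinkClique v S ∧ G.IsLinkClique v T ∧ (S ∩ T).Nonempty
  symm := ⟨fun S T h => ⟨h.1.symm, h.2.2.1, h.2.1, by rw [Set.inter_comm]; exact h.2.2.2⟩⟩
  loopless := ⟨fun S h => h.1 rfl⟩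

namespace IsBasisGraphLike

variable {v : V}

theorem adj_of_mem_linkClique (hG : G.IsBasisGraphLike) {a b x y : V} (hva : G.Adj v a)
    (hvb : G.Adj v b) (hab : G.Adj a b) (hx : x ∈ G.linkClique v a b)
    (hy : y ∈ G.linkClique v a b) (hxy : x ≠ y) : G.Adj x y := by
  obtain ⟨hvx, hxa, hxb⟩ := hx
  obtain ⟨hvy, hya, hyb⟩ := hy
  rcases hxa with rfl | hxa
  · rcases hya with rfl | hya
    · exact absurd rfl hxy
    · exact hya.symm
  rcases hxb with rfl | hxb
  · rcases hyb with rfl | hyb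
    · exact absurd rfl hxy
    · exact hyb.symm
  rcases hya with rfl | hya
  · exact hxa
  rcases hyb with rfl | hyb
  · exact hxb
  exact hG.no_diamond hvx hvy hva hvb hab hxa.symm hya.symm hxb.symm hyb.symm hxy

theorem linkClique_subset (hG : G.IsBasisGraphLike) {a b x y : V} (hva : G.Adj v a)
    (hvb : G.Adj v b) (hab : G.Adj a b) (hx : x ∈ G.linkClique v a b)
    (hy : y ∈ G.linkClique v a b) : G.linkClique v a b ⊆ G.linkClique v x y := by
  intro z hz
  refine ⟨hz.1, ?_, ?_⟩
  · by_cases hzx : z = x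
    · exact Or.inl hzx
    · exact Or.inr (hG.adj_of_mem_linkClique hva hvb hab hz hx hzx)
  · by_cases hzy : z = y
    · exact Or.inl hzy
    · exact Or.inr (hG.adj_of_mem_linkClique hva hvb hab hz hy hzy)

theorem left_mem_linkClique {a b : V} (hva : G.Adj v a) (hab : G.Adj a b) :
    a ∈ G.linkClique v a b := ⟨hva, Or.inl rfl, Or.inr hab⟩

theorem right_mem_linkClique {a b : V} (hvb : G.Adj v b) (hab : G.Adj a b) :
    b ∈ G.linkClique v a b := ⟨hvb, Or.inr hab.symm, Or.inl rfl⟩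

/-- Since any two members of such a set are adjacent, it is determined by any two of them: every
edge of the link lies in exactly one clique. -/
theorem linkClique_eq (hG : G.IsBasisGraphLike) {a b x y : V} (hva : G.Adj v a)
    (hvb : G.Adj v b) (hab : G.Adj a b) (hx : x ∈ G.linkClique v a b)
    (hy : y ∈ G.linkClique v a b) (hxy : x ≠ y) : G.linkClique v x y = G.linkClique v a b := by
  have hsub := hG.linkClique_subset hva hvb hab hx hy
  have hadj := hG.adj_of_mem_linkClique hva hvb hab hx hy hxy
  exact Set.Subset.antisymm (hG.linkClique_subset hx.1 hy.1 hadj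
    (hsub (left_mem_linkClique hva hab)) (hsub (right_mem_linkClique hvb hab))) hsub

end IsBasisGraphLike

namespace IsLinkClique

variable {v : V} {S T U : Set V}

theorem adj_center (hS : G.IsLinkClique v S) {x : V} (hx : x ∈ S) : G.Adj v x := by
  obtain ⟨a, b, -, -, -, rfl⟩ := hS
  exact hx.1

theorem adj (hS : G.IsLinkClique v S) (hG : G.IsBasisGraphLike) {x y : V} (hx : x ∈ S)
    (hy : y ∈ S) (hxy : x ≠ y) : G.Adj x y := by
  obtain ⟨a, b, hva, hvb, hab, rfl⟩ := hS
  exact hG.adj_of_mem_linkClique hva hvb hab hx hy hxy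

theorem linkClique_eq (hS : G.IsLinkClique v S) (hG : G.IsBasisGraphLike) {x y : V} (hx : x ∈ S)
    (hy : y ∈ S) (hxy : x ≠ y) : G.linkClique v x y = S := by
  obtain ⟨a, b, hva, hvb, hab, rfl⟩ := hS
  exact hG.linkClique_eq hva hvb hab hx hy hxy

theorem exists_ne (hS : G.IsLinkClique v S) (x : V) : ∃ y ∈ S, y ≠ x := by
  obtain ⟨a, b, hva, hvb, hab, rfl⟩ := hS
  by_cases hax : a = x
  · subst hax
    exact ⟨b, IsBasisGraphLike.right_mem_linkClique hvb hab, hab.ne.symm⟩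
  · exact ⟨a, IsBasisGraphLike.left_mem_linkClique hva hab, hax⟩

/-- A vertex of the link lies in at most two cliques. -/
theorem not_three (hG : G.IsBasisGraphLike) (hS : G.IsLinkClique v S) (hT : G.IsLinkClique v T)
    (hU : G.IsLinkClique v U) (hST : S ≠ T) (hSU : S ≠ U) (hTU : T ≠ U) {x : V} (hxS : x ∈ S)
    (hxT : x ∈ T) (hxU : x ∈ U) : False := by
  have key : ∀ {S T : Set V}, G.IsLinkClique v S → G.IsLinkClique v T → S ≠ T → x ∈ S → x ∈ T →
      ∀ {a b}, a ∈ S → b ∈ T → a ≠ x → b ≠ x → a ≠ b ∧ ¬ G.Adj a b := by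
    intro S T hS hT hST hxS hxT a b ha hb hax hbx
    have h1 := hS.linkClique_eq hG ha hxS hax
    have h2 := hT.linkClique_eq hG hb hxT hbx
    constructor
    · rintro rfl
      exact hST (h1.symm.trans h2)
    · intro hadj
      have hmem : b ∈ S := by
        rw [← h1]
        exact ⟨hT.adj_center hb, Or.inr hadj.symm, Or.inr (hT.adj hG hb hxT hbx)⟩
      exact hST ((hS.linkClique_eq hG hmem hxS hbx).symm.trans h2)
  obtain ⟨a, ha, hax⟩ := hS.exists_ne x
  obtain ⟨b, hb, hbx⟩ := hT.exists_ne x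
  obtain ⟨c, hc, hcx⟩ := hU.exists_ne x
  obtain ⟨hab, hab'⟩ := key hS hT hST hxS hxT ha hb hax hbx
  obtain ⟨hac, hac'⟩ := key hS hU hSU hxS hxU ha hc hax hcx
  obtain ⟨hbc, hbc'⟩ := key hT hU hTU hxT hxU hb hc hbx hcx
  exact hG.no_claw (hS.adj_center ha) (hT.adj_center hb) (hU.adj_center hc) (hS.adj_center hxS)
    (hS.adj hG hxS ha hax.symm) (hT.adj hG hxT hb hbx.symm) (hU.adj hG hxU hc hcx.symm)
    hab hac hbc hab' hac' hbc'

end IsLinkClique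

namespace IsBasisGraphLike

variable {v : V}

/-- Along an odd cycle of cliques `s i`, choose `u i` in `s i ∩ s (i + 1)`. As no vertex lies in
three cliques, the `u i` form an odd hole if `n ≥ 5`; for `n = 3` the clique `s 1` would also
contain `u 2`, which lies in `s 2` and `s 0`. -/
theorem linkCliqueGraph_colorable (hG : G.IsBasisGraphLike) (v : V) :
    (G.linkCliqueGraph v).Colorable 2 := by
  by_contra hcol
  obtain ⟨n, s, hodd, hloop, hadj, hinj⟩ := exists_odd_cycle_of_not_colorable_two hcol
  have hn3 : 3 ≤ n := by
    by_contra hlt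
    have hn1 : n = 1 := by obtain ⟨k, rfl⟩ := hodd; omega
    subst hn1
    exact (hadj 0 (by omega)).1 hloop.symm
  have hcl : ∀ i, i ≤ n → G.IsLinkClique v (s i) := by
    intro i hi
    rcases hi.lt_or_eq with hlt | rfl
    · exact (hadj i hlt).2.1
    · rw [hloop]
      exact (hadj 0 (by omega)).2.1
  have hinj' : ∀ i j, i < j → j ≤ n → ¬ (i = 0 ∧ j = n) → s i ≠ s j := by
    intro i j hij hj hne
    rcases hj.lt_or_eq with hlt | rfl
    · exact hinj i j hij hlt
    · rw [hloop]
      exact (hinj 0 i (by omega) hij).symm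
  have hu : ∀ i, ∃ x, i < n → x ∈ s i ∧ x ∈ s (i + 1) := by
    intro i
    by_cases hi : i < n
    · obtain ⟨x, hx⟩ := (hadj i hi).2.2.2
      exact ⟨x, fun _ => hx⟩
    · exact ⟨v, fun h => absurd h hi⟩
  choose u hu using hu
  have key : ∀ {x i j k}, i < j → j < k → k ≤ n → ¬ (i = 0 ∧ k = n) → x ∈ s i → x ∈ s j →
      x ∈ s k → False := fun hij hjk hk hne h1 h2 h3 =>
    IsLinkClique.not_three hG (hcl _ (by omega)) (hcl _ (by omega)) (hcl _ hk)
      (hinj' _ _ hij (by omega) (by omega)) (hinj' _ _ (by omega) hk hne)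
      (hinj' _ _ hjk hk (by omega)) h1 h2 h3
  have hlast := hu (n - 1) (by omega)
  rw [show n - 1 + 1 = n by omega, hloop] at hlast
  have hne : ∀ i j, i < j → j < n → u i ≠ u j := by
    intro i j hij hj heq
    have h1 := hu i (by omega)
    have h2 := hu j hj
    rw [← heq] at h2
    by_cases hin : i = 0 ∧ j = n - 1
    · obtain ⟨rfl, rfl⟩ := hin
      exact key (i := 0) (j := 1) (k := n - 1) (by omega) (by omega) (by omega) (by omega)
        h1.1 h1.2 h2.1
    · by_cases hij' : j = i + 1
      · subst hij'
        exact key (i := i) (j := i + 1) (k := i + 2) (by omega) (by omega) (by omega) (by omega)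
          h1.1 h1.2 h2.2
      · exact key (i := i) (j := i + 1) (k := j) (by omega) (by omega) (by omega) (by omega)
          h1.1 h1.2 h2.1
  by_cases h5 : 5 ≤ n
  · refine hG.not_isLinkHole n h5 hodd v u ⟨fun i hi => (hcl i hi.le).adj_center (hu i hi).1, hne,
      fun i j hij hj => ⟨fun hA => ?_, fun hc => ?_⟩⟩
    · by_contra hcon
      have h1 := hu i (by omega)
      have h2 := hu j hj
      have c1 := hcl i (by omega)
      have c2 := hcl (i + 1) (by omega)
      have c3 := hcl j (by omega)
      have c4 := hcl (j + 1) (by omega)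
      have d1 := hinj' i (i + 1) (by omega) (by omega) (by omega)
      have d2 := hinj' i j hij (by omega) (by omega)
      have d3 := hinj' (i + 1) j (by omega) (by omega) (by omega)
      have d4 := hinj' i (j + 1) (by omega) (by omega) (by omega)
      have d5 := hinj' (i + 1) (j + 1) (by omega) (by omega) (by omega)
      have d6 := hinj' j (j + 1) (by omega) (by omega) (by omega)
      have hvi := c1.adj_center h1.1
      have hvj := c3.adj_center h2.1
      -- The clique through `u i` and `u j` must be one of the two known cliques at each of them,
      -- and these four are distinct where needed.
      have cT : G.IsLinkClique v (G.linkClique v (u i) (u j)) := ⟨_, _, hvi, hvj, hA, rfl⟩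
      have mi := left_mem_linkClique hvi hA
      have mj := right_mem_linkClique hvj hA
      have e1 : G.linkClique v (u i) (u j) = s i ∨ G.linkClique v (u i) (u j) = s (i + 1) := by
        by_contra! hno
        exact IsLinkClique.not_three hG cT c1 c2 hno.1 hno.2 d1 mi h1.1 h1.2
      have e2 : G.linkClique v (u i) (u j) = s j ∨ G.linkClique v (u i) (u j) = s (j + 1) := by
        by_contra! hno
        exact IsLinkClique.not_three hG cT c3 c4 hno.1 hno.2 d6 mj h2.1 h2.2
      rcases e1 with e1 | e1 <;> rcases e2 with e2 | e2 <;> rw [e1] at e2 <;> contradiction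
    · rcases hc with rfl | ⟨rfl, hc⟩
      · exact (hcl (i + 1) (by omega)).adj hG (hu i (by omega)).2 (hu (i + 1) hj).1
          (hne _ _ (by omega) hj)
      · obtain rfl : j = n - 1 := by omega
        exact (hcl 0 (by omega)).adj hG (hu 0 (by omega)).1 hlast.2 (hne _ _ (by omega) hj)
  · obtain rfl : n = 3 := by obtain ⟨k, rfl⟩ := hodd; omega
    have m0 := hu 0 (by omega)
    have m1 := hu 1 (by omega)
    have m2 : u 2 ∈ s 1 := by
      rw [← (hcl 1 (by omega)).linkClique_eq hG m0.2 m1.1 (hne 0 1 (by omega) (by omega))]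
      exact ⟨(hcl 0 (by omega)).adj_center hlast.2,
        Or.inr ((hcl 0 (by omega)).adj hG hlast.2 m0.1 (hne 0 2 (by omega) (by omega)).symm),
        Or.inr ((hcl 2 (by omega)).adj hG hlast.1 m1.2 (hne 1 2 (by omega) (by omega)).symm)⟩
    exact key (i := 0) (j := 1) (k := 2) (by omega) (by omega) (by omega) (by omega)
      hlast.2 m2 hlast.1

/-- The link of a vertex is the line graph of a bipartite graph: its vertices have coordinates
`r` and `c`, and two distinct vertices are adjacent iff they agree in exactly one of them. -/
theorem exists_link_coordinates (hG : G.IsBasisGraphLike) (v : V) :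
    ∃ r c : G.neighborSet v → G.neighborSet v, ∀ u w : G.neighborSet v, u ≠ w →
      ¬ (r u = r w ∧ c u = c w) ∧ (G.Adj u w ↔ (r u = r w ∨ c u = c w)) := by
  obtain ⟨color⟩ := hG.linkCliqueGraph_colorable v
  have comm : ∀ a b, G.linkClique v a b = G.linkClique v b a := by
    intro a b
    ext x
    simp only [linkClique, Set.mem_ofPred_eq]
    tauto
  let R : Fin 2 → Setoid (G.neighborSet v) := fun k =>
    { r := fun u w => u = w ∨ (G.Adj u w ∧ color (G.linkClique v u w) = k)
      iseqv := by
        refine ⟨fun u => Or.inl rfl, ?_, ?_⟩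
        · rintro u w (rfl | ⟨h1, h2⟩)
          · exact Or.inl rfl
          · exact Or.inr ⟨h1.symm, by rwa [comm]⟩
        · rintro u w x (rfl | ⟨h1, h2⟩) (rfl | ⟨h3, h4⟩)
          · exact Or.inl rfl
          · exact Or.inr ⟨h3, h4⟩
          · exact Or.inr ⟨h1, h2⟩
          · by_cases hux : u = x
            · exact Or.inl hux
            · right
              have c1 : G.IsLinkClique v (G.linkClique v u w) := ⟨_, _, u.2, w.2, h1, rfl⟩
              have c2 : G.IsLinkClique v (G.linkClique v w x) := ⟨_, _, w.2, x.2, h3, rfl⟩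
              have mw := right_mem_linkClique w.2 h1
              -- Distinct cliques sharing `w` have different colors.
              have heq : G.linkClique v u w = G.linkClique v w x := by
                by_contra hne
                exact color.valid (show (G.linkCliqueGraph v).Adj _ _ from
                  ⟨hne, c1, c2, w, mw, left_mem_linkClique w.2 h3⟩) (h2.trans h4.symm)
              have mx := right_mem_linkClique x.2 h3
              rw [← heq] at mx
              have hne : (u : V) ≠ x := fun t => hux (Subtype.ext t)
              have mu := left_mem_linkClique u.2 h1
              exact ⟨c1.adj hG mu mx hne, by rwa [c1.linkClique_eq hG mu mx hne]⟩ }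
  have hR : ∀ k u w, (Quotient.mk (R k) u).out = (Quotient.mk (R k) w).out ↔
      u = w ∨ (G.Adj u w ∧ color (G.linkClique v u w) = k) := by
    intro k u w
    rw [Quotient.out_inj]
    exact Quotient.eq (r := R k)
  -- Representatives keep the coordinates inside the neighbor set, which bounds their number.
  refine ⟨fun u => (Quotient.mk (R 0) u).out, fun u => (Quotient.mk (R 1) u).out,
    fun u w huw => ?_⟩
  simp only [hR, huw, false_or]
  generalize color (G.linkClique v u w) = k
  constructor
  · rintro ⟨⟨-, rfl⟩, -, h⟩
    exact absurd h (by decide)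
  · fin_cases k <;> simp

end IsBasisGraphLike

end SimpleGraph

/-! ### Isometric labelling by subsets of a finite set. -/

namespace SimpleGraph

variable {V : Type*} {G : SimpleGraph V}

theorem Connected.exists_dist_eq_dist_eq (hG : G.Connected) {u v : V} {a b : ℕ}
    (h : G.dist u v = a + b) : ∃ w, G.dist u w = a ∧ G.dist w v = b := by
  obtain ⟨p, hp⟩ := hG.exists_walk_length_eq_dist u v
  have h1 := dist_le (p.take a)
  have h2 := dist_le (p.drop a)
  have h3 := hG.dist_triangle (u := u) (v := p.getVert a) (w := v)
  rw [Walk.take_length] at h1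
  rw [Walk.drop_length] at h2
  exact ⟨p.getVert a, by omega, by omega⟩

end SimpleGraph

namespace Finset

variable {α : Type*} [DecidableEq α]

theorem card_symmDiff_add_two_mul_card_inter (A B : Finset α) :
    (symmDiff A B).card + 2 * (A ∩ B).card = A.card + B.card := by
  have h1 := card_sdiff_add_card_inter A B
  have h2 := card_sdiff_add_card_inter B A
  rw [inter_comm B A] at h2
  have h3 : (symmDiff A B).card = (A \ B).card + (B \ A).card := by
    rw [symmDiff, sup_eq_union, card_union_of_disjoint disjoint_sdiff_sdiff]
  omega

/-- This is the set counterpart of the positioning condition: with `P`, `Q` on one diagonal of a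
square, `P ∪ Q` and `P ∩ Q` are on the other. -/
theorem card_symmDiff_union_add_card_symmDiff_inter (A P Q : Finset α) :
    (symmDiff A (P ∪ Q)).card + (symmDiff A (P ∩ Q)).card =
      (symmDiff A P).card + (symmDiff A Q).card := by
  have h1 := card_symmDiff_add_two_mul_card_inter A (P ∪ Q)
  have h2 := card_symmDiff_add_two_mul_card_inter A (P ∩ Q)
  have h3 := card_symmDiff_add_two_mul_card_inter A P
  have h4 := card_symmDiff_add_two_mul_card_inter A Q
  have h5 := card_union_add_card_inter P Q
  have h6 := card_union_add_card_inter (A ∩ P) (A ∩ Q)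
  rw [← inter_union_distrib_left, ← inter_inter_distrib_left] at h6
  omega

end Finset

namespace SimpleGraph.IsBasisGraphLike

variable {V : Type*} {G : SimpleGraph V}

/-- The label records the symmetric difference with the basis at `v`: left elements are those
removed, right elements those added, in equal numbers. The radius is `k + 1`, so that the base case
is the link itself, labelled by its coordinates. -/
theorem exists_ball_embedding (hG : G.IsBasisGraphLike) (v : V) {m : ℕ}
    (r c : G.neighborSet v → Fin m) (hrc : ∀ u w : G.neighborSet v, u ≠ w →
      ¬ (r u = r w ∧ c u = c w) ∧ (G.Adj u w ↔ (r u = r w ∨ c u = c w))) (k : ℕ) :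
    ∃ φ : V → Finset (Fin m ⊕ Fin m), φ v = ∅ ∧
      (∀ x, G.dist v x ≤ k + 1 → (φ x).toLeft.card = (φ x).toRight.card) ∧
      ∀ x y, G.dist v x ≤ k + 1 → G.dist v y ≤ k + 1 →
        (symmDiff (φ x) (φ y)).card = 2 * G.dist x y := by
  classical
  induction k with
  | zero =>
    let ψ : G.neighborSet v → Finset (Fin m ⊕ Fin m) := fun u => {Sum.inl (r u), Sum.inr (c u)}
    let φ : V → Finset (Fin m ⊕ Fin m) := fun x => if h : G.Adj v x then ψ ⟨x, h⟩ else ∅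
    have hv : φ v = ∅ := dif_neg G.irrefl
    have hφ : ∀ u : G.neighborSet v, φ u = ψ u := fun u => dif_pos u.2
    have hψ : ∀ u, (ψ u).card = 2 := fun u => Finset.card_pair (by simp)
    have hball : ∀ x, G.dist v x ≤ 0 + 1 → x = v ∨ ∃ u : G.neighborSet v, x = u := by
      intro x hx
      by_cases hxv : x = v
      · exact Or.inl hxv
      · have := hG.conn.pos_dist_of_ne (fun t => hxv t.symm : v ≠ x)
        exact Or.inr ⟨⟨x, dist_eq_one_iff_adj.1 (by omega)⟩, rfl⟩
    refine ⟨φ, hv, fun x hx => ?_, fun x y hx hy => ?_⟩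
    · rcases hball x hx with rfl | ⟨u, rfl⟩
      · rw [hv]; rfl
      · rw [hφ]
        have h1 : (ψ u).toLeft = {r u} := by ext; simp [ψ]
        have h2 : (ψ u).toRight = {c u} := by ext; simp [ψ]
        rw [h1, h2]; rfl
    · rcases hball x hx with rfl | ⟨u, rfl⟩ <;> rcases hball y hy with rfl | ⟨w, rfl⟩
      · simp
      · rw [hφ, hv, ← Finset.bot_eq_empty, bot_symmDiff, hψ, dist_eq_one_iff_adj.2 w.2]
      · rw [hφ, hv, ← Finset.bot_eq_empty, symmDiff_bot, hψ, dist_eq_one_iff_adj.2 u.2.symm]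
      · rw [hφ, hφ]
        by_cases huw : u = w
        · subst huw; simp
        obtain ⟨h1, h2⟩ := hrc u w huw
        have h3 := Finset.card_symmDiff_add_two_mul_card_inter (ψ u) (ψ w)
        rw [hψ, hψ] at h3
        by_cases hadj : G.Adj u w
        · rw [dist_eq_one_iff_adj.2 hadj]
          have h4 : (ψ u ∩ ψ w).card = 1 := by
            rw [Finset.card_eq_one]
            rcases h2.1 hadj with h | h
            · refine ⟨Sum.inl (r u), ?_⟩
              ext a
              simp only [ψ, Finset.mem_inter, Finset.mem_insert, Finset.mem_singleton, ← h]
              rcases a with a | a <;> simp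
              rintro rfl h5
              exact h1 ⟨h, h5⟩
            · refine ⟨Sum.inr (c u), ?_⟩
              ext a
              simp only [ψ, Finset.mem_inter, Finset.mem_insert, Finset.mem_singleton, ← h]
              rcases a with a | a <;> simp
              rintro rfl h5
              exact h1 ⟨h5, h⟩
          omega
        · rw [hG.dist_eq_two (fun t => huw (Subtype.ext t)) hadj u.2.symm w.2.symm]
          have h4 : ψ u ∩ ψ w = ∅ := by
            rw [h2] at hadj
            push Not at hadj
            ext a
            simp only [ψ, Finset.mem_inter, Finset.mem_insert, Finset.mem_singleton]
            rcases a with a | a <;> simp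
            · rintro rfl
              exact hadj.1
            · rintro rfl
              exact hadj.2
          rw [h4, Finset.card_empty] at h3
          omega
  | succ k ih =>
    obtain ⟨φ, hv, hbal, hiso⟩ := ih
    have hstep : ∀ x, ∃ z p q, G.dist v x = k + 2 →
        G.dist v z = k ∧ G.dist v p = k + 1 ∧ G.dist v q = k + 1 ∧ φ z = φ p ∩ φ q ∧
        ∀ y, G.dist y x + G.dist y z = G.dist y p + G.dist y q := by
      intro x
      by_cases hx : G.dist v x = k + 2
      · obtain ⟨z, hvz, hzx⟩ := hG.conn.exists_dist_eq_dist_eq hx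
        obtain ⟨p, q, hzp, hxp, hzq, hxq, hpq, hpq'⟩ := hG.exists_square hzx
        have hlevel : ∀ a, G.Adj z a → G.Adj x a → G.dist v a = k + 1 := by
          intro a hza hxa
          have h1 := hG.conn.dist_triangle (u := v) (v := z) (w := a)
          have h2 := hG.conn.dist_triangle (u := v) (v := a) (w := x)
          rw [dist_eq_one_iff_adj.2 hza] at h1
          rw [dist_eq_one_iff_adj.2 hxa.symm] at h2
          omega
        have hvp := hlevel p hzp hxp
        have hvq := hlevel q hzq hxq
        have hcard : ∀ a, G.dist v a ≤ k + 1 → (φ a).card = 2 * G.dist v a := by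
          intro a ha
          have := hiso v a (by simp) ha
          rwa [hv, ← Finset.bot_eq_empty, bot_symmDiff] at this
        have hsub : ∀ a, G.Adj z a → G.dist v a = k + 1 → φ z ⊆ φ a := by
          intro a hza hva
          have h1 := hiso z a (by omega) (by omega)
          have h2 := Finset.card_symmDiff_add_two_mul_card_inter (φ z) (φ a)
          rw [h1, dist_eq_one_iff_adj.2 hza, hcard z (by omega), hcard a (by omega)] at h2
          rw [← Finset.inter_eq_left]
          exact Finset.eq_of_subset_of_card_le Finset.inter_subset_left
            (by rw [hcard z (by omega)]; omega)
        -- One inclusion is `hsub`; equality follows because both sides have `2 * k` elements, as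
        -- `d(p,q) = 2`.
        have hinter : φ z = φ p ∩ φ q := by
          have h1 := hiso p q (by omega) (by omega)
          have h2 := Finset.card_symmDiff_add_two_mul_card_inter (φ p) (φ q)
          rw [h1, hG.dist_eq_two hpq hpq' hzp.symm hzq.symm, hcard p (by omega),
            hcard q (by omega)] at h2
          exact Finset.eq_of_subset_of_card_le
            (Finset.subset_inter (hsub p hzp hvp) (hsub q hzq hvq))
            (by rw [hcard z (by omega)]; omega)
        refine ⟨z, p, q, fun _ => ⟨hvz, hvp, hvq, hinter, fun y => ?_⟩⟩
        have hne : z ≠ x := by rintro rfl; simp at hzx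
        have hadj : ¬ G.Adj z x := by rw [← dist_eq_one_iff_adj]; omega
        have := hG.positioning y z p x q hzp hxp.symm hxq hzq.symm hne hadj hpq hpq'
        omega
      · exact ⟨x, x, x, fun h => absurd h hx⟩
    choose z p q hzpq using hstep
    let φ' : V → Finset (Fin m ⊕ Fin m) := fun x =>
      if G.dist v x ≤ k + 1 then φ x else φ (p x) ∪ φ (q x)
    have hold : ∀ x, G.dist v x ≤ k + 1 → φ' x = φ x := fun x hx => if_pos hx
    have hnew : ∀ x, G.dist v x = k + 2 → φ' x = φ (p x) ∪ φ (q x) := fun x hx =>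
      if_neg (by omega)
    -- `A` stands for a label of `y`, whether old or new; this allows the extension to be made in
    -- one argument and then in the other.
    have hext : ∀ (A : Finset (Fin m ⊕ Fin m)) (y : V), (∀ x, G.dist v x ≤ k + 1 →
        (symmDiff A (φ x)).card = 2 * G.dist y x) → ∀ x, G.dist v x ≤ k + 1 + 1 →
        (symmDiff A (φ' x)).card = 2 * G.dist y x := by
      intro A y hA x hx
      by_cases hx' : G.dist v x ≤ k + 1
      · rw [hold x hx', hA x hx']
      · have hx2 : G.dist v x = k + 2 := by omega
        obtain ⟨h1, h2, h3, h4, h5⟩ := hzpq x hx2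
        have h6 := Finset.card_symmDiff_union_add_card_symmDiff_inter A (φ (p x)) (φ (q x))
        rw [← h4, hA _ (by omega), hA _ (by omega), hA _ (by omega)] at h6
        rw [hnew x hx2]
        have := h5 y
        omega
    refine ⟨φ', by rw [hold v (by simp), hv], fun x hx => ?_, fun x y hx hy => ?_⟩
    · by_cases hx' : G.dist v x ≤ k + 1
      · rw [hold x hx']
        exact hbal x hx'
      · have hx2 : G.dist v x = k + 2 := by omega
        obtain ⟨h1, h2, h3, h4, h5⟩ := hzpq x hx2
        have e1 := hbal _ (by omega : G.dist v (z x) ≤ k + 1)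
        have e2 := hbal _ h2.le
        have e3 := hbal _ h3.le
        rw [hnew x hx2, Finset.toLeft_union, Finset.toRight_union]
        rw [h4, Finset.toLeft_inter, Finset.toRight_inter] at e1
        have e4 := Finset.card_union_add_card_inter (φ (p x)).toLeft (φ (q x)).toLeft
        have e5 := Finset.card_union_add_card_inter (φ (p x)).toRight (φ (q x)).toRight
        omega
    · refine hext _ x (fun y hy' => ?_) y hy
      rw [symmDiff_comm, dist_comm]
      exact hext _ y (fun x' hx' => by rw [symmDiff_comm, dist_comm]; exact hiso _ _ hx' hy') x hx

/-- A basis-graph-like graph with a vertex of finite degree embeds isometrically into the graph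
of subsets of constant size of a finite set. -/
theorem exists_isometric_embedding (hG : G.IsBasisGraphLike) {v : V}
    (hv : (G.neighborSet v).Finite) : ∃ (I : Type) (_ : Fintype I) (_ : DecidableEq I)
      (B : V → Finset I), ∀ x y, (B x \ B y).card = G.dist x y := by
  obtain ⟨r, c, hrc⟩ := hG.exists_link_coordinates v
  have : Finite (G.neighborSet v) := hv
  obtain ⟨m, ⟨e⟩⟩ := Finite.exists_equiv_fin (G.neighborSet v)
  obtain ⟨φ, hφv, hbal, hiso⟩ := hG.exists_ball_embedding v (e ∘ r) (e ∘ c)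
    (by simpa only [Function.comp_apply, e.injective.eq_iff] using hrc) m
  have hcard : ∀ a, G.dist v a ≤ m + 1 → (φ a).card = 2 * G.dist v a := by
    intro a ha
    have := hiso v a (by simp) ha
    rwa [hφv, ← Finset.bot_eq_empty, bot_symmDiff] at this
  -- A vertex at distance `m + 1` would have a label of `2 * (m + 1)` elements in a set of size `2 *
  -- m`.
  have hdist : ∀ x, G.dist v x ≤ m + 1 := by
    intro x
    by_contra! hlt
    obtain ⟨y, hy, -⟩ := hG.conn.exists_dist_eq_dist_eq (u := v) (v := x) (a := m + 1)
      (b := G.dist v x - (m + 1)) (by omega)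
    have h1 := hcard y hy.le
    have h2 := Finset.card_le_univ (φ y)
    simp only [Fintype.card_sum, Fintype.card_fin] at h2
    omega
  -- `R` plays the basis at `v`; the symmetric difference with `R` turns balanced labels into sets
  -- of size `m` without changing distances.
  let R : Finset (Fin m ⊕ Fin m) := Finset.univ.disjSum ∅
  have hB : ∀ x, (symmDiff (φ x) R).card = m := by
    intro x
    have h1 := Finset.card_symmDiff_add_two_mul_card_inter (φ x) R
    have h2 : (φ x ∩ R).card = (φ x).toLeft.card := by
      rw [← Finset.card_toLeft_add_card_toRight, Finset.toLeft_inter, Finset.toRight_inter,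
        show R.toLeft = Finset.univ by ext; simp [R], show R.toRight = ∅ by ext; simp [R]]
      simp
    have h3 : R.card = m := by simp [R]
    have h4 := Finset.card_toLeft_add_card_toRight (u := φ x)
    have h5 := hbal x (hdist x)
    omega
  refine ⟨Fin m ⊕ Fin m, inferInstance, inferInstance, fun x => symmDiff (φ x) R, fun x y => ?_⟩
  have h1 : symmDiff (symmDiff (φ x) R) (symmDiff (φ y) R) = symmDiff (φ x) (φ y) := by
    rw [symmDiff_symmDiff_symmDiff_comm, symmDiff_self, symmDiff_bot]
  have h2 := hiso x y (hdist x) (hdist y)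
  rw [← h1, symmDiff, Finset.sup_eq_union,
    Finset.card_union_of_disjoint disjoint_sdiff_sdiff] at h2
  have h3 := Finset.card_sdiff_comm ((hB x).trans (hB y).symm)
  dsimp only
  omega

/-! ### Basis exchange for the labels, and the resulting matroid. -/

theorem exchange (hG : G.IsBasisGraphLike) {I : Type*} [DecidableEq I] {B : V → Finset I}
    (hB : ∀ x y, (B x \ B y).card = G.dist x y) {x y : V} {e : I} (hex : e ∈ B x)
    (hey : e ∉ B y) : ∃ f ∈ B y \ B x, ∃ w, B w = insert f ((B x).erase e) := by
  obtain ⟨d, hd⟩ : ∃ d, G.dist x y = d := ⟨_, rfl⟩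
  induction d using Nat.strong_induction_on generalizing y with
  | _ d ih =>
  have he : e ∈ B x \ B y := Finset.mem_sdiff.2 ⟨hex, hey⟩
  have hxy := hB x y
  have hyx := hB y x
  rw [dist_comm] at hyx
  rw [hd] at hxy hyx
  by_cases h0 : d = 0
  · subst h0
    rw [Finset.card_eq_zero] at hxy
    simp [hxy] at he
  by_cases h1 : d = 1
  · subst h1
    obtain ⟨e', he'⟩ := Finset.card_eq_one.1 hxy
    obtain ⟨f, hf⟩ := Finset.card_eq_one.1 hyx
    rw [he', Finset.mem_singleton] at he
    subst he
    refine ⟨f, by simp [hf], y, ?_⟩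
    ext a
    have h1 := Finset.ext_iff.1 he' a
    have h2 := Finset.ext_iff.1 hf a
    simp only [Finset.mem_sdiff, Finset.mem_singleton] at h1 h2
    simp only [Finset.mem_insert, Finset.mem_erase]
    grind
  -- Induction on the distance: on a square just before `y`, one side vertex at distance `d - 1`
  -- from `x` also avoids `e`, and can replace `y`.
  obtain ⟨z, hxz, hzy⟩ := hG.conn.exists_dist_eq_dist_eq (u := x) (v := y) (a := d - 2) (b := 2)
    (by omega)
  obtain ⟨p, q, hzp, hyp, hzq, hyq, hpq, hpq'⟩ := hG.exists_square hzy
  have key : ∀ a, G.Adj z a → G.Adj y a → e ∉ B a →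
      ∃ f ∈ B y \ B x, ∃ w, B w = insert f ((B x).erase e) := by
    intro a hza hya hea
    have h1 := hG.conn.dist_triangle (u := x) (v := z) (w := a)
    have h2 := hG.conn.dist_triangle (u := x) (v := a) (w := y)
    rw [dist_eq_one_iff_adj.2 hza] at h1
    rw [dist_eq_one_iff_adj.2 hya.symm] at h2
    have hxa : G.dist x a = d - 1 := by omega
    obtain ⟨f, hf, w, hw⟩ := ih (d - 1) (by omega) hea hxa
    refine ⟨f, Finset.mem_sdiff.2 ⟨?_, (Finset.mem_sdiff.1 hf).2⟩, w, hw⟩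
    by_contra hfy
    -- If `f` were not in `B y`, the right side would have at most `1 + (d - 2)` elements, too few
    -- for the left side.
    have hsub : B y \ B x ⊆ (B y \ B a) ∪ (B a \ B x).erase f := by
      intro b hb
      simp only [Finset.mem_union, Finset.mem_erase, Finset.mem_sdiff] at hb ⊢
      grind
    have h3 := (Finset.card_le_card hsub).trans (Finset.card_union_le _ _)
    rw [Finset.card_erase_of_mem hf, hB, hB, hB, dist_eq_one_iff_adj.2 hya, dist_comm (u := a),
      dist_comm (u := y)] at h3
    omega
  by_cases hep : e ∈ B p
  · by_cases heq : e ∈ B q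
    · exfalso
      have h1 := hB p y
      rw [dist_eq_one_iff_adj.2 hyp.symm, Finset.card_eq_one] at h1
      obtain ⟨e', he'⟩ := h1
      have hsub : B p \ B q ⊆ B y \ B q := by
        intro b hb
        have h1 := Finset.ext_iff.1 he' b
        have h2 := Finset.ext_iff.1 he' e
        simp only [Finset.mem_sdiff, Finset.mem_singleton] at hb h1 h2 ⊢
        grind
      have h2 := Finset.card_le_card hsub
      rw [hB, hB, dist_eq_one_iff_adj.2 hyq, hG.dist_eq_two hpq hpq' hzp.symm hzq.symm] at h2
      omega
    · exact key q hzq hyq heq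
  · exact key p hzp hyp hep

theorem isMatroidBasisGraph (hG : G.IsBasisGraphLike) {v : V} (hv : (G.neighborSet v).Finite) :
    G.IsMatroidBasisGraph := by
  obtain ⟨I, hI, hdec, B, hB⟩ := hG.exists_isometric_embedding hv
  let M : Matroid I := Matroid.ofIsBaseOfFinite (E := Set.univ) Set.finite_univ
    (fun S => ∃ x, S = B x) ⟨_, v, rfl⟩
    (by
      rintro _ _ ⟨x, rfl⟩ ⟨y, rfl⟩ e ⟨hex, hey⟩
      obtain ⟨f, hf, w, hw⟩ := hG.exchange hB (x := x) (y := y) (e := e)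
        (by simpa using hex) (by simpa using hey)
      exact ⟨f, by simpa using hf, w, by simp [hw]⟩)
    (fun _ _ => Set.subset_univ _)
  have hinj : Function.Injective B := by
    intro x y hxy
    rw [← hG.conn.dist_eq_zero_iff, ← hB, hxy]
    simp
  let f : V → {S : Set I // M.IsBase S} := fun x => ⟨B x, x, rfl⟩
  have hf : Function.Bijective f := by
    constructor
    · intro x y hxy
      exact hinj (Finset.coe_injective congr($hxy.1))
    · rintro ⟨_, x, rfl⟩
      exact ⟨x, rfl⟩
  refine ⟨I, inferInstance, M, ⟨⟨Equiv.ofBijective f hf, ?_⟩⟩⟩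
  intro x y
  change (symmDiff (B x : Set I) (B y)).ncard = 2 ↔ _
  rw [← Finset.coe_symmDiff, Set.ncard_coe_finset, symmDiff, Finset.sup_eq_union,
    Finset.card_union_of_disjoint disjoint_sdiff_sdiff, hB, hB, dist_comm (u := y),
    ← dist_eq_one_iff_adj]
  omega

end SimpleGraph.IsBasisGraphLike

/-! ### Converse: symmetric exchange between bases. -/

theorem Matroid.IsBase.exists_symm_exchange {α : Type*} {M : Matroid α} {A B : Set α} {e : α}
    (hA : M.IsBase A) (hB : M.IsBase B) (heA : e ∈ A) (heB : e ∉ B) :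
    ∃ f ∈ B \ A, M.IsBase (insert f (A \ {e})) ∧ M.IsBase (insert e (B \ {f})) := by
  have heE : e ∈ M.E := hA.subset_ground heA
  have hC := hB.fundCircuit_isCircuit heE heB
  have heC := M.mem_fundCircuit e B
  -- If the fundamental circuit without `e` lay in the closure of `A \ {e}`, so would `e`,
  -- contradicting the independence of `A`.
  obtain ⟨f, hf, hfcl⟩ : ∃ f ∈ M.fundCircuit e B \ {e}, f ∉ M.closure (A \ {e}) := by
    by_contra! hcon
    have h1 := hC.mem_closure_sdiff_singleton_of_mem heC
    have h2 := M.closure_subset_closure_of_subset_closure (X := M.fundCircuit e B \ {e})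
      (Y := A \ {e}) hcon
    exact hA.indep.notMem_closure_sdiff_of_mem heA (h2 h1)
  have hfB : f ∈ B := (M.fundCircuit_subset_insert e B hf.1).resolve_left hf.2
  have hfA : f ∉ A := fun hfA => hfcl (M.mem_closure_of_mem' ⟨hfA, hf.2⟩ (hA.subset_ground hfA))
  refine ⟨f, ⟨hfB, hfA⟩, hA.exchange_base_of_notMem_closure heA hfcl (hB.subset_ground hfB), ?_⟩
  rw [Set.insert_sdiff_singleton_comm (Ne.symm hf.2)]
  refine hB.exchange_isBase_of_indep' hfB heB ?_
  exact (hB.indep.mem_fundCircuit_iff (by rw [hB.closure_eq]; exact heE) heB).1 hf.1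

/-! ### Recognizing squares, pyramids and octahedra. -/

namespace SimpleGraph

variable {V W : Type*} {G : SimpleGraph V}

theorem nonempty_induce_iso {H : SimpleGraph W} {S : Set V} (f : W → V)
    (hf : Function.Injective f) (hadj : ∀ i j, G.Adj (f i) (f j) ↔ H.Adj i j)
    (hS : ∀ x, x ∈ S ↔ ∃ i, f i = x) : Nonempty (G.induce S ≃g H) := by
  let g : W → S := fun i => ⟨f i, (hS _).2 ⟨i, rfl⟩⟩
  have hg : Function.Bijective g := by
    refine ⟨fun i j hij => hf congr($hij.1), ?_⟩
    rintro ⟨x, hx⟩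
    obtain ⟨i, rfl⟩ := (hS x).1 hx
    exact ⟨i, rfl⟩
  exact ⟨RelIso.symm ⟨Equiv.ofBijective g hg, @fun i j => hadj i j⟩⟩

section square

variable {S : Set V} {u v p q : V} (huv : u ≠ v) (huv' : ¬ G.Adj u v) (hpq : p ≠ q)
  (hpq' : ¬ G.Adj p q) (hup : G.Adj u p) (huq : G.Adj u q) (hvp : G.Adj v p) (hvq : G.Adj v q)

include huv hpq hup huq hvp hvq in
theorem square_injective : Function.Injective ![u, p, v, q] := by
  have := hup.ne; have := huq.ne; have := hvp.ne; have := hvq.ne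
  intro i j
  fin_cases i <;> fin_cases j <;> simp_all [eq_comm]

include huv' hpq' hup huq hvp hvq in
theorem square_adj_iff (i j : Fin 4) :
    G.Adj (![u, p, v, q] i) (![u, p, v, q] j) ↔ (cycleGraph 4).Adj i j := by
  have hvu : ¬ G.Adj v u := fun h => huv' h.symm
  have hqp : ¬ G.Adj q p := fun h => hpq' h.symm
  fin_cases i <;> fin_cases j <;> first
    | exact iff_of_true hup (by decide)
    | exact iff_of_true huq (by decide)
    | exact iff_of_true hvp (by decide)
    | exact iff_of_true hvq (by decide)
    | exact iff_of_true hup.symm (by decide)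
    | exact iff_of_true huq.symm (by decide)
    | exact iff_of_true hvp.symm (by decide)
    | exact iff_of_true hvq.symm (by decide)
    | exact iff_of_false huv' (by decide)
    | exact iff_of_false hvu (by decide)
    | exact iff_of_false hpq' (by decide)
    | exact iff_of_false hqp (by decide)
    | exact iff_of_false (G.irrefl) (by decide)

include huv huv' hpq hpq' hup huq hvp hvq

theorem nonempty_induce_iso_cycleGraph_four
    (hS : ∀ x, x ∈ S ↔ x = u ∨ x = v ∨ x = p ∨ x = q) :
    Nonempty (G.induce S ≃g cycleGraph 4) := by
  refine nonempty_induce_iso ![u, p, v, q] (square_injective huv hpq hup huq hvp hvq)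
    (square_adj_iff huv' hpq' hup huq hvp hvq) fun x => ?_
  rw [hS]
  simp [Fin.exists_fin_succ, eq_comm]
  tauto

theorem nonempty_induce_iso_pyramid {x : V} (hux : G.Adj u x) (hvx : G.Adj v x)
    (hpx : G.Adj p x) (hqx : G.Adj q x) (hS : ∀ y, y ∈ S ↔ y = u ∨ y = v ∨ y = p ∨ y = q ∨ y = x) :
    Nonempty (G.induce S ≃g pyramid) := by
  have hx : ∀ i, G.Adj (![u, p, v, q] i) x := by
    intro i
    fin_cases i
    exacts [hux, hpx, hvx, hqx]
  refine nonempty_induce_iso (fun i : Option (Fin 4) => i.elim x ![u, p, v, q]) ?_ ?_ fun y => ?_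
  · rintro (_ | i) (_ | j) hij
    · rfl
    · exact absurd hij.symm (hx j).ne
    · exact absurd hij (hx i).ne
    · exact congrArg some (square_injective huv hpq hup huq hvp hvq hij)
  · rintro (_ | i) (_ | j)
    · exact iff_of_false G.irrefl id
    · exact iff_of_true (hx j).symm trivial
    · exact iff_of_true (hx i) trivial
    · exact square_adj_iff huv' hpq' hup huq hvp hvq i j
  · rw [hS]
    simp [Option.exists, Fin.exists_fin_succ, eq_comm]
    tauto

theorem nonempty_induce_iso_octahedron {x y : V} (hux : G.Adj u x) (hvx : G.Adj v x)
    (hpx : G.Adj p x) (hqx : G.Adj q x) (huy : G.Adj u y) (hvy : G.Adj v y)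
    (hpy : G.Adj p y) (hqy : G.Adj q y) (hxy : x ≠ y) (hxy' : ¬ G.Adj x y)
    (hS : ∀ z, z ∈ S ↔ z = u ∨ z = v ∨ z = p ∨ z = q ∨ z = x ∨ z = y) :
    Nonempty (G.induce S ≃g octahedron) := by
  let f : Fin 3 → Fin 2 → V := ![![u, v], ![p, q], ![x, y]]
  have hf : ∀ i j i' j', i < i' → G.Adj (f i j) (f i' j') := by
    intro i j i' j' hii'
    fin_cases i <;> fin_cases i' <;> first
      | exact absurd hii' (by decide)
      | (fin_cases j <;> fin_cases j' <;> assumption)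
  have hf' : ∀ i j i' j', i ≠ i' → G.Adj (f i j) (f i' j') := fun i j i' j' hne =>
    hne.lt_or_gt.elim (hf i j i' j') fun h => (hf i' j' i j h).symm
  have hf'' : ∀ i, f i 0 ≠ f i 1 ∧ ¬ G.Adj (f i 0) (f i 1) := by
    intro i
    fin_cases i
    exacts [⟨huv, huv'⟩, ⟨hpq, hpq'⟩, ⟨hxy, hxy'⟩]
  refine nonempty_induce_iso (fun i : Fin 3 × Fin 2 => f i.1 i.2) ?_ ?_ fun z => ?_
  · rintro ⟨i, j⟩ ⟨i', j'⟩ hij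
    by_cases hii' : i = i'
    · subst hii'
      have := (hf'' i).1
      fin_cases j <;> fin_cases j'
      · rfl
      · exact absurd hij this
      · exact absurd hij.symm this
      · rfl
    · exact absurd hij (hf' i j i' j' hii').ne
  · rintro ⟨i, j⟩ ⟨i', j'⟩
    rw [completeEquipartiteGraph_adj]
    by_cases hii' : i = i'
    · subst hii'
      refine iff_of_false ?_ (fun h => h rfl)
      have := (hf'' i).2
      fin_cases j <;> fin_cases j'
      · exact G.irrefl
      · exact this
      · exact fun h => this h.symm
      · exact G.irrefl
    · exact iff_of_true (hf' i j i' j' hii') hii'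
  · rw [hS]
    simp [f, Prod.exists, Fin.exists_fin_succ, eq_comm]
    tauto

end square

/-! ### Distances, positioning and intervals under a basis labelling. -/

/-- A labelling of the vertices of `G` by finite sets of equal size, which satisfies symmetric
exchange and under which adjacency means differing by one exchange. -/
structure IsBasisLabelling {I : Type*} [DecidableEq I] (G : SimpleGraph V) (B : V → Finset I) :
    Prop where
  injective : Function.Injective B
  card_eq : ∀ x y, (B x).card = (B y).card
  adj_iff : ∀ x y, G.Adj x y ↔ (B x \ B y).card = 1
  exchange : ∀ x y e, e ∈ B x → e ∉ B y → ∃ f, f ∈ B y ∧ f ∉ B x ∧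
    (∃ w, B w = insert f ((B x).erase e)) ∧ ∃ w, B w = insert e ((B y).erase f)

namespace IsBasisLabelling

variable {I : Type*} [DecidableEq I] {B : V → Finset I}

theorem card_sdiff_comm (hB : G.IsBasisLabelling B) (x y : V) :
    (B x \ B y).card = (B y \ B x).card := Finset.card_sdiff_comm (hB.card_eq x y)

theorem exists_walk (hB : G.IsBasisLabelling B) (x y : V) :
    ∃ w : G.Walk x y, w.length = (B x \ B y).card := by
  obtain ⟨n, hn⟩ : ∃ n, (B x \ B y).card = n := ⟨_, rfl⟩
  induction n generalizing x with
  | zero =>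
    have hxy : x = y := hB.injective (Finset.eq_of_subset_of_card_le
      (by rwa [Finset.card_eq_zero, Finset.sdiff_eq_empty_iff_subset] at hn) (hB.card_eq y x).le)
    subst hxy
    exact ⟨Walk.nil, by simp⟩
  | succ n ih =>
    obtain ⟨e, he⟩ := Finset.card_pos.1 (by omega : 0 < (B x \ B y).card)
    have he' := Finset.mem_sdiff.1 he
    obtain ⟨f, hfy, hfx, ⟨w, hw⟩, -⟩ := hB.exchange x y e he'.1 he'.2
    have h1 : B x \ B w = {e} := by
      rw [hw]
      ext a
      simp only [Finset.mem_sdiff, Finset.mem_insert, Finset.mem_erase, Finset.mem_singleton]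
      grind
    have h2 : B w \ B y = (B x \ B y).erase e := by
      rw [hw]
      ext a
      simp only [Finset.mem_sdiff, Finset.mem_insert, Finset.mem_erase]
      grind
    have h3 : (B w \ B y).card = n := by rw [h2, Finset.card_erase_of_mem he]; omega
    obtain ⟨p, hp⟩ := ih w h3
    exact ⟨Walk.cons ((hB.adj_iff x w).2 (by rw [h1]; rfl)) p, by rw [Walk.length_cons]; omega⟩

theorem card_sdiff_le (hB : G.IsBasisLabelling B) {x y : V} (w : G.Walk x y) :
    (B x \ B y).card ≤ w.length := by
  induction w with
  | nil => simp
  | @cons x z y h p ih =>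
    have h1 := (hB.adj_iff x z).1 h
    have h2 : B x \ B y ⊆ (B x \ B z) ∪ (B z \ B y) := by
      intro a
      simp only [Finset.mem_union, Finset.mem_sdiff]
      tauto
    have h3 := (Finset.card_le_card h2).trans (Finset.card_union_le _ _)
    rw [Walk.length_cons]
    omega

theorem preconnected (hB : G.IsBasisLabelling B) : G.Preconnected := fun x y =>
  (hB.exists_walk x y).elim fun w _ => ⟨w⟩

theorem dist_eq (hB : G.IsBasisLabelling B) (x y : V) : G.dist x y = (B x \ B y).card := by
  obtain ⟨w, hw⟩ := hB.exists_walk x y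
  obtain ⟨w', hw'⟩ := (hB.preconnected x y).exists_walk_length_eq_dist
  have h1 := dist_le w
  have h2 := hB.card_sdiff_le w'
  omega

/-- Each step of the path `x`, `w`, `y` changes one element, and `B x \ B y` has at least two, so
neither step can be wasted. -/
theorem between (hB : G.IsBasisLabelling B) {x y w : V} (hxy : x ≠ y) (hxy' : ¬ G.Adj x y)
    (hxw : G.Adj x w) (hwy : G.Adj w y) : B x ∩ B y ⊆ B w ∧ B w ⊆ B x ∪ B y := by
  have h2 : 2 ≤ (B x \ B y).card := by
    have h3 := (hB.preconnected x y).one_lt_dist_of_ne_of_not_adj hxy hxy'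
    rwa [hB.dist_eq] at h3
  rw [hB.adj_iff, Finset.card_eq_one] at hxw hwy
  obtain ⟨s, hs⟩ := hxw
  obtain ⟨t, ht⟩ := hwy
  constructor <;> intro a ha <;> by_contra hcon
  · have hsub : B x \ B y ⊆ B w \ B y := by
      intro b hb
      have e1 := Finset.ext_iff.1 hs a
      have e2 := Finset.ext_iff.1 hs b
      simp only [Finset.mem_sdiff, Finset.mem_singleton, Finset.mem_inter] at ha hb e1 e2 ⊢
      grind
    have := Finset.card_le_card hsub
    rw [ht, Finset.card_singleton] at this
    omega
  · have hsub : B x \ B y ⊆ B x \ B w := by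
      intro b hb
      have e1 := Finset.ext_iff.1 ht a
      have e2 := Finset.ext_iff.1 ht b
      simp only [Finset.mem_sdiff, Finset.mem_singleton, Finset.mem_union] at hcon hb e1 e2 ⊢
      grind
    have := Finset.card_le_card hsub
    rw [hs, Finset.card_singleton] at this
    omega

/-- Applying `between` to both diagonals shows that they have the same intersection and the same
union, and these determine the sum of the distances from `v`. -/
theorem positioningCondition (hB : G.IsBasisLabelling B) : G.PositioningCondition := by
  intro v u
  have hadj : ∀ i j, (cycleGraph 4).Adj i j → G.Adj (u i) (u j) := fun i j h =>
    u.map_adj_iff.2 h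
  have hadj' : ∀ i j, ¬ (cycleGraph 4).Adj i j → ¬ G.Adj (u i) (u j) := fun i j h h' =>
    h (u.map_adj_iff.1 h')
  have hne : ∀ i j, i ≠ j → u i ≠ u j := fun i j h => u.injective.ne h
  have key : ∀ i j k, i ≠ k → ¬ (cycleGraph 4).Adj i k → (cycleGraph 4).Adj i j →
      (cycleGraph 4).Adj j k → B (u i) ∩ B (u k) ⊆ B (u j) ∧ B (u j) ⊆ B (u i) ∪ B (u k) :=
    fun i j k h1 h2 h3 h4 => hB.between (hne _ _ h1) (hadj' _ _ h2) (hadj _ _ h3) (hadj _ _ h4)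
  have k1 := key 0 1 2 (by decide) (by decide) (by decide) (by decide)
  have k2 := key 0 3 2 (by decide) (by decide) (by decide) (by decide)
  have k3 := key 1 0 3 (by decide) (by decide) (by decide) (by decide)
  have k4 := key 1 2 3 (by decide) (by decide) (by decide) (by decide)
  have hinter : B (u 0) ∩ B (u 2) = B (u 1) ∩ B (u 3) :=
    Finset.Subset.antisymm (Finset.subset_inter k1.1 k2.1) (Finset.subset_inter k3.1 k4.1)
  have hunion : B (u 0) ∪ B (u 2) = B (u 1) ∪ B (u 3) :=
    Finset.Subset.antisymm (Finset.union_subset k3.2 k4.2) (Finset.union_subset k1.2 k2.2)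
  have hsum : ∀ P Q : Finset I, (B v \ P).card + (B v \ Q).card =
      (B v \ (P ∩ Q)).card + (B v \ (P ∪ Q)).card := by
    intro P Q
    rw [← Finset.card_union_add_card_inter,
      show B v \ P ∪ B v \ Q = B v \ (P ∩ Q) by ext; simp; tauto,
      show (B v \ P) ∩ (B v \ Q) = B v \ (P ∪ Q) by ext; simp; tauto]
  rw [hB.dist_eq, hB.dist_eq, hB.dist_eq, hB.dist_eq, hsum (B (u 0)), hsum (B (u 1)), hinter,
    hunion]

/-- With `B u \ B v = {a, a'}` and `B v \ B u = {f, f'}`, a common neighbor replaces one of `a`,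
`a'` by one of `f`, `f'` in `B u`. Symmetric exchange supplies two complementary replacements `p`
and `q`. Zero, one or both of the remaining two may be bases, giving the three shapes. -/
theorem intervalCondition (hB : G.IsBasisLabelling B) : G.IntervalCondition := by
  intro u v huv
  have hne : u ≠ v := by rintro rfl; simp at huv
  have hnadj : ¬ G.Adj u v := by rw [← dist_eq_one_iff_adj]; omega
  have hinterval : ∀ x, x ∈ G.interval u v ↔ x = u ∨ x = v ∨ (G.Adj u x ∧ G.Adj v x) := by
    intro x
    have h1 : G.dist u x = 0 ↔ u = x := (hB.preconnected u x).dist_eq_zero_iff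
    have h2 : G.dist x v = 0 ↔ x = v := (hB.preconnected x v).dist_eq_zero_iff
    have h3 := dist_eq_one_iff_adj (G := G) (u := u) (v := x)
    have h4 := dist_eq_one_iff_adj (G := G) (u := x) (v := v)
    rw [G.adj_comm v x, ← h3, ← h4, ← h2, eq_comm, ← h1]
    simp only [interval, Set.mem_ofPred_eq, huv]
    constructor
    · omega
    · rintro (h | h | h)
      · rw [h1] at h
        subst h
        simpa using huv
      · rw [h2] at h
        subst h
        simpa using huv
      · omega
  have hcard : (B u \ B v).card = 2 := by rw [← hB.dist_eq, huv]
  have hcard' : (B v \ B u).card = 2 := by rw [← hB.card_sdiff_comm, hcard]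
  obtain ⟨a, ha⟩ := Finset.card_pos.1 (by omega : 0 < (B u \ B v).card)
  rw [Finset.mem_sdiff] at ha
  obtain ⟨f, hfv, hfu, ⟨p, hp⟩, q, hq⟩ := hB.exchange u v a ha.1 ha.2
  obtain ⟨a', ha'⟩ : ∃ a', (B u \ B v).erase a = {a'} := by
    rw [← Finset.card_eq_one, Finset.card_erase_of_mem (Finset.mem_sdiff.2 ha), hcard]
  obtain ⟨f', hf'⟩ : ∃ f', (B v \ B u).erase f = {f'} := by
    rw [← Finset.card_eq_one, Finset.card_erase_of_mem (Finset.mem_sdiff.2 ⟨hfv, hfu⟩), hcard']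
  have A : ∀ b, b ∈ B u ∧ b ∉ B v ↔ b = a ∨ b = a' := by
    intro b
    have := Finset.ext_iff.1 ha' b
    simp only [Finset.mem_erase, Finset.mem_sdiff, Finset.mem_singleton] at this
    grind
  have F : ∀ b, b ∈ B v ∧ b ∉ B u ↔ b = f ∨ b = f' := by
    intro b
    have := Finset.ext_iff.1 hf' b
    simp only [Finset.mem_erase, Finset.mem_sdiff, Finset.mem_singleton] at this
    grind
  have haa' : a ≠ a' := by
    have := Finset.ext_iff.1 ha' a
    simpa using this
  have hff' : f ≠ f' := by
    have := Finset.ext_iff.1 hf' f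
    simpa using this
  have memA' := (A a').2 (Or.inr rfl)
  have memF' := (F f').2 (Or.inr rfl)
  -- Exchanging `f` for `a` in `B v` amounts to exchanging `a'` for `f'` in `B u`.
  have hq' : B q = insert f' ((B u).erase a') := by
    rw [hq]
    ext b
    have h1 := A b
    have h2 := F b
    simp only [Finset.mem_insert, Finset.mem_erase]
    grind
  have adj_of_eq : ∀ x y s t, s ∈ B x → s ∉ B y → (∀ b, b ∈ B y ↔ b = t ∨ (b ≠ s ∧ b ∈ B x)) →
      G.Adj x y := by
    intro x y s t hs hs' h
    rw [hB.adj_iff, Finset.card_eq_one]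
    refine ⟨s, ?_⟩
    ext b
    have := h b
    simp only [Finset.mem_sdiff, Finset.mem_singleton]
    grind
  have not_adj : ∀ x y s t, s ≠ t → s ∈ B x → s ∉ B y → t ∈ B x → t ∉ B y → ¬ G.Adj x y := by
    intro x y s t hst h1 h2 h3 h4 hadj
    rw [hB.adj_iff, Finset.card_eq_one] at hadj
    obtain ⟨r, hr⟩ := hadj
    have e1 := Finset.ext_iff.1 hr s
    have e2 := Finset.ext_iff.1 hr t
    simp only [Finset.mem_sdiff, Finset.mem_singleton] at e1 e2
    grind
  have adj_center : ∀ x s t, (s = a ∨ s = a') → (t = f ∨ t = f') →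
      B x = insert t ((B u).erase s) → G.Adj u x ∧ G.Adj v x := by
    intro x s t hs ht hx
    have hs1 := (A s).2 hs
    have ht1 := (F t).2 ht
    have hx' : ∀ b, b ∈ B x ↔ b = t ∨ (b ≠ s ∧ b ∈ B u) := by intro b; rw [hx]; simp
    constructor
    · exact adj_of_eq u x s t hs1.1 (by grind) hx'
    · obtain ⟨s', hs', hss'⟩ : ∃ s', (s' = a ∨ s' = a') ∧ s ≠ s' := by
        rcases hs with rfl | rfl
        · exact ⟨a', Or.inr rfl, haa'⟩
        · exact ⟨a, Or.inl rfl, haa'.symm⟩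
      obtain ⟨t', ht', htt'⟩ : ∃ t', (t' = f ∨ t' = f') ∧ t ≠ t' := by
        rcases ht with rfl | rfl
        · exact ⟨f', Or.inr rfl, hff'⟩
        · exact ⟨f, Or.inl rfl, hff'.symm⟩
      have ht2 := (F t').2 ht'
      refine adj_of_eq v x t' s' ht2.1 (by grind) fun b => ?_
      have h1 := A b
      have h2 := F b
      have h3 := hx' b
      grind
  have common : ∀ x, G.Adj u x → G.Adj v x → B x = B p ∨ B x = B q ∨
      B x = insert f' ((B u).erase a) ∨ B x = insert f ((B u).erase a') := by
    intro x hux hvx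
    obtain ⟨h1, h2⟩ := hB.between hne hnadj hux hvx.symm
    have h3 := hux
    have h4 := hux.symm
    rw [hB.adj_iff, Finset.card_eq_one] at h3 h4
    obtain ⟨s, hs⟩ := h3
    obtain ⟨t, ht⟩ := h4
    have hs' : ∀ b, b ∈ B u ∧ b ∉ B x ↔ b = s := by
      intro b; have := Finset.ext_iff.1 hs b; simpa using this
    have ht' : ∀ b, b ∈ B x ∧ b ∉ B u ↔ b = t := by
      intro b; have := Finset.ext_iff.1 ht b; simpa using this
    have hs1 := (hs' s).2 rfl
    have ht1 := (ht' t).2 rfl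
    have hsA : s = a ∨ s = a' := by
      rw [← A]
      refine ⟨hs1.1, fun hsv => hs1.2 (h1 (Finset.mem_inter.2 ⟨hs1.1, hsv⟩))⟩
    have htF : t = f ∨ t = f' := by
      rw [← F]
      exact ⟨(Finset.mem_union.1 (h2 ht1.1)).resolve_left ht1.2, ht1.2⟩
    have hx : B x = insert t ((B u).erase s) := by
      ext b
      have h5 := hs' b
      have h6 := ht' b
      simp only [Finset.mem_insert, Finset.mem_erase]
      grind
    rw [hx, hp, hq']
    rcases hsA with rfl | rfl <;> rcases htF with rfl | rfl <;> simp
  obtain ⟨hup, hvp⟩ := adj_center p a f (Or.inl rfl) (Or.inl rfl) hp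
  obtain ⟨huq, hvq⟩ := adj_center q a' f' (Or.inr rfl) (Or.inr rfl) hq'
  have hpq' : ¬ G.Adj p q := not_adj p q f a' (by grind) (by simp [hp])
    (by simp [hq']; grind) (by simp [hp]; grind) (by simp [hq']; grind)
  have hpq : p ≠ q := by
    rintro rfl
    have h1 : f ∈ B p := by simp [hp]
    rw [hq'] at h1
    simp at h1
    grind
  have adj_pq : ∀ x, (B x = insert f' ((B u).erase a) ∨ B x = insert f ((B u).erase a')) →
      G.Adj p x ∧ G.Adj q x := by
    intro x hx
    have hp' : ∀ b, b ∈ B p ↔ b = f ∨ (b ≠ a ∧ b ∈ B u) := by intro b; rw [hp]; simp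
    have hq'' : ∀ b, b ∈ B q ↔ b = f' ∨ (b ≠ a' ∧ b ∈ B u) := by intro b; rw [hq']; simp
    rcases hx with hx | hx
    · have hx' : ∀ b, b ∈ B x ↔ b = f' ∨ (b ≠ a ∧ b ∈ B u) := by intro b; rw [hx]; simp
      exact ⟨adj_of_eq p x f f' (by grind) (by grind) (by grind),
        adj_of_eq q x a a' (by grind) (by grind) (by grind)⟩
    · have hx' : ∀ b, b ∈ B x ↔ b = f ∨ (b ≠ a' ∧ b ∈ B u) := by intro b; rw [hx]; simp
      exact ⟨adj_of_eq p x a' a (by grind) (by grind) (by grind),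
        adj_of_eq q x f' f (by grind) (by grind) (by grind)⟩
  by_cases hX : ∃ x, B x = insert f' ((B u).erase a)
  · obtain ⟨x, hx⟩ := hX
    obtain ⟨hux, hvx⟩ := adj_center x a f' (Or.inl rfl) (Or.inr rfl) hx
    obtain ⟨hpx, hqx⟩ := adj_pq x (Or.inl hx)
    by_cases hY : ∃ y, B y = insert f ((B u).erase a')
    · obtain ⟨y, hy⟩ := hY
      obtain ⟨huy, hvy⟩ := adj_center y a' f (Or.inr rfl) (Or.inl rfl) hy
      obtain ⟨hpy, hqy⟩ := adj_pq y (Or.inr hy)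
      have hxy' : ¬ G.Adj x y := not_adj x y f' a' (by grind) (by simp [hx])
        (by simp [hy]; grind) (by simp [hx]; grind) (by simp [hy]; grind)
      have hxy : x ≠ y := by
        rintro rfl
        have h1 : f ∈ B x := by simp [hy]
        rw [hx] at h1
        simp at h1
        grind
      refine Or.inr (Or.inr (nonempty_induce_iso_octahedron hne hnadj hpq hpq' hup huq hvp hvq
        hux hvx hpx hqx huy hvy hpy hqy hxy hxy' fun z => ?_))
      rw [hinterval]
      have := common z
      rw [← hx, ← hy] at this
      simp only [hB.injective.eq_iff] at this
      grind
    · refine Or.inr (Or.inl (nonempty_induce_iso_pyramid hne hnadj hpq hpq' hup huq hvp hvq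
        hux hvx hpx hqx fun z => ?_))
      rw [hinterval]
      have := common z
      rw [← hx] at this
      simp only [hB.injective.eq_iff] at this
      grind
  · by_cases hY : ∃ y, B y = insert f ((B u).erase a')
    · obtain ⟨y, hy⟩ := hY
      obtain ⟨huy, hvy⟩ := adj_center y a' f (Or.inr rfl) (Or.inl rfl) hy
      obtain ⟨hpy, hqy⟩ := adj_pq y (Or.inr hy)
      refine Or.inr (Or.inl (nonempty_induce_iso_pyramid hne hnadj hpq hpq' hup huq hvp hvq
        huy hvy hpy hqy fun z => ?_))
      rw [hinterval]
      have := common z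
      rw [← hy] at this
      simp only [hB.injective.eq_iff] at this
      grind
    · refine Or.inl (nonempty_induce_iso_cycleGraph_four hne hnadj hpq hpq' hup huq hvp hvq
        fun z => ?_)
      rw [hinterval]
      have := common z
      simp only [hB.injective.eq_iff] at this
      grind

end IsBasisLabelling

theorem IsMatroidBasisGraph.conditions (h : G.IsMatroidBasisGraph) :
    G.Connected ∧ G.IntervalCondition ∧ G.PositioningCondition ∧
      ∃ v : V, (G.neighborSet v).Finite := by
  classical
  obtain ⟨I, hI, M, ⟨e⟩⟩ := h
  have := Fintype.ofFinite I
  let B : V → Finset I := fun x => (e x : Set I).toFinset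
  have hbase : ∀ x, M.IsBase (B x : Set I) := by
    intro x
    rw [Set.coe_toFinset]
    exact (e x).2
  have hsurj : ∀ S : Finset I, M.IsBase (S : Set I) → ∃ x, B x = S := fun S hS =>
    ⟨e.symm ⟨S, hS⟩, by simp [B]⟩
  have hcard : ∀ x y, (B x).card = (B y).card := by
    intro x y
    rw [← Set.ncard_coe_finset, ← Set.ncard_coe_finset]
    exact (hbase x).ncard_eq_ncard_of_isBase (hbase y)
  have hB : G.IsBasisLabelling B := by
    refine ⟨fun x y hxy => ?_, hcard, fun x y => ?_, fun x y a hax hay => ?_⟩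
    · apply e.injective
      exact Subtype.ext (by simpa [B] using hxy)
    · rw [← e.map_adj_iff]
      change (symmDiff (e x : Set I) (e y : Set I)).ncard = 2 ↔ _
      have h1 : symmDiff (e x : Set I) (e y : Set I) = (symmDiff (B x) (B y) : Finset I) := by
        simp [B]
      rw [h1, Set.ncard_coe_finset, symmDiff, Finset.sup_eq_union,
        Finset.card_union_of_disjoint disjoint_sdiff_sdiff, Finset.card_sdiff_comm (hcard y x)]
      omega
    · obtain ⟨f, hf, h1, h2⟩ := (hbase x).exists_symm_exchange (hbase y)
        (e := a) (by simpa using hax) (by simpa using hay)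
      exact ⟨f, by simpa using hf.1, by simpa using hf.2, hsurj _ (by simpa using h1),
        hsurj _ (by simpa using h2)⟩
  have : Finite V := Finite.of_injective B hB.injective
  obtain ⟨S, hS⟩ := M.exists_isBase
  let v : V := e.symm ⟨S, hS⟩
  have : Nonempty V := ⟨v⟩
  exact ⟨⟨hB.preconnected⟩, hB.intervalCondition, hB.positioningCondition, v, Set.toFinite _⟩

end SimpleGraph

theorem theorem1p1 {V : Type*} (G : SimpleGraph V) :
    G.IsMatroidBasisGraph ↔
      G.Connected ∧ G.IntervalCondition ∧ G.PositioningCondition ∧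
        ∃ v : V, (G.neighborSet v).Finite := by
  constructor
  · exact fun h => h.conditions
  · rintro ⟨hc, hi, hp, v, hv⟩
    exact (SimpleGraph.IsBasisGraphLike.of_conditions hc hi hp).isMatroidBasisGraph hv
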